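/- Let $G$ be a compact (Hausdorff) group with normalized Haar measure, so $\int_G dx=1$, and let $\langle u,v\rangle=\int_G u(x)\,v(x)^*\,dx$ on $L^2(G)$. Let $\widehat G$ be the unitary dual of $G$; in each class $\eta\in\widehat G$ fix a unitary matrix representation $\eta:G\to U(d_\eta)$. Put $\widehat v(\eta)=\int_G v(x)\,\eta(x)^*\,dx$ and, for matrix-valued functions on $\widehat G$, $\int \widehat a(\eta)\,d\eta=\sum_{\eta\in\widehat G} d_\eta\,\mathrm{tr}(\widehat a(\eta))$. The Hilbert spaces $L^2(G\times\widehat G)$ and $L^2(\widehat G\times G)$ of matrix-valued functions (the value at $\eta$ being a $d_\eta\times d_\eta$ matrix) carry the inner product $\langle b,a\rangle=\sum_{\eta\in\widehat G} d_\eta\int_G \mathrm{tr}\big(b(x,\eta)\,a(x,\eta)^*\big)\,dx$. The symplectic Fourier transform $F:L^2(G\times\widehat G)\to L^2(\widehat G\times G)$ and its inverse are $$Fa(\xi,y)=\int \xi(x)^*\int \eta(y)\,a(x,\eta)\,d\eta\,dx,\qquad F^{-1}b(x,\eta)=\int \eta(y)^*\int \xi(x)\,b(\xi,y)\,d\xi\,dy,$$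 the inner Fourier series being summed in $L^2(G\times G)$. For $u,v\in L^2(G)$ the Kohn–Nirenberg transform is $R(u,v)(x,\eta)=u(x)\,\eta(x)^*\,\widehat v(\eta)^*$, and the Kohn–Nirenberg operator with symbol $a$ is $a^Rv(x)=\int \eta(x)\,a(x,\eta)\,\widehat v(\eta)\,d\eta$. For a measurable matrix-valued ambiguity kernel $\phi_D$ on $\widehat G\times G$ put $$D(u,v)=F^{-1}\big(\phi_D\,FR(u,v)\big),\qquad \|\phi_D\|_{L^\infty}=\sup_{\xi\in\widehat G}\,\operatorname*{ess\,sup}_{y\in G}\|\phi_D(\xi,y)\|_{op}$$ (for $\phi_D$ continuous in $y$ this is the supremum of $\|\phi_D(\xi,y)\|_{op}$ over all $(\xi,y)$). **Theorem.** (i) Suppose $\|\phi_D\|_{L^\infty}<\infty$. Then for all $u,v\in L^2(G)$ the series defining $D(u,v)$ converge in $L^2(G\times G)$, $D(u,v)\in L^2(G\times\widehat G)$, and $$\|D(u,v)\|\le\|\phi_D\|_{L^\infty}\,\|u\|\,\|v\|.$$ For every $a\in L^2(G\times\widehat G)$ there is a unique operator $a^D$ on $L^2(G)$ with $\langle u,a^Dv\rangle=\langle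 D(u,v),a\rangle$ for all $u,v\in L^2(G)$; it is linear and bounded, and for all $v\in L^2(G)$ $$\|a^Dv\|\le\|\phi_D\|_{L^\infty}\,\|a\|\,\|v\|.$$ (ii) For all $u,v\in L^2(G)$, $R(u,v)\in L^2(G\times\widehat G)$ and $\|R(u,v)\|=\|u\|\,\|v\|$. For all $a\in L^2(G\times\widehat G)$ and $v\in L^2(G)$ the series defining $a^Rv(x)$ converges absolutely for almost every $x\in G$, $a^Rv\in L^2(G)$, $\langle u,a^Rv\rangle=\langle R(u,v),a\rangle$ for all $u\in L^2(G)$, and $\|a^Rv\|\le\|a\|\,\|v\|$. -/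

import Mathlib

open MeasureTheory
open scoped Matrix ENNReal

namespace TimeFreq

section Dual

variable (G : Type*) [Group G] [TopologicalSpace G]

/-- An irreducible continuous unitary matrix representation `x ↦ η(x) ∈ U(d_η)` of `G`. -/
structure UnitaryIrrep where
  dim : ℕ
  dim_pos : 0 < dim
  toHom : G →* Matrix.unitaryGroup (Fin dim) ℂ
  continuous_toHom : Continuous toHom
  irreducible : ∀ W : Submodule ℂ (Fin dim → ℂ),
    (∀ x : G, ∀ w ∈ W, (toHom x : Matrix (Fin dim) (Fin dim) ℂ) *ᵥ w ∈ W) → W = ⊥ ∨ W = ⊤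

variable {G}

/-- Unitary equivalence: there is a unitary `U` with `U ξ(x) = η(x) U` for all `x`. -/
def UnitaryIrrep.Equivalent (ξ η : UnitaryIrrep G) : Prop :=
  ∃ U : Matrix (Fin η.dim) (Fin ξ.dim) ℂ, U * Uᴴ = 1 ∧ Uᴴ * U = 1 ∧
    ∀ x : G, U * (ξ.toHom x : Matrix (Fin ξ.dim) (Fin ξ.dim) ℂ)
      = (η.toHom x : Matrix (Fin η.dim) (Fin η.dim) ℂ) * U

theorem UnitaryIrrep.equivalent_refl (ξ : UnitaryIrrep G) : ξ.Equivalent ξ :=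
  ⟨1, by simp, by simp, by simp⟩

theorem UnitaryIrrep.Equivalent.symm {ξ η : UnitaryIrrep G} (h : ξ.Equivalent η) :
    η.Equivalent ξ := by
  obtain ⟨U, h1, h2, h3⟩ := h
  refine ⟨Uᴴ, by simpa using h2, by simpa using h1, fun x => ?_⟩
  calc Uᴴ * (η.toHom x : Matrix (Fin η.dim) (Fin η.dim) ℂ)
      = Uᴴ * ((η.toHom x : Matrix (Fin η.dim) (Fin η.dim) ℂ) * U) * Uᴴ := by
        rw [Matrix.mul_assoc, Matrix.mul_assoc, h1, Matrix.mul_one]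
    _ = (ξ.toHom x : Matrix (Fin ξ.dim) (Fin ξ.dim) ℂ) * Uᴴ := by
        rw [← h3, ← Matrix.mul_assoc, h2, Matrix.one_mul]

theorem UnitaryIrrep.Equivalent.trans {ξ η ζ : UnitaryIrrep G} (h : ξ.Equivalent η)
    (h' : η.Equivalent ζ) : ξ.Equivalent ζ := by
  obtain ⟨U, h1, h2, h3⟩ := h
  obtain ⟨V, k1, k2, k3⟩ := h'
  refine ⟨V * U, ?_, ?_, fun x => ?_⟩
  · rw [Matrix.conjTranspose_mul, Matrix.mul_assoc, ← Matrix.mul_assoc U, h1, Matrix.one_mul, k1]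
  · rw [Matrix.conjTranspose_mul, Matrix.mul_assoc, ← Matrix.mul_assoc Vᴴ, k2, Matrix.one_mul, h2]
  · rw [Matrix.mul_assoc, h3, ← Matrix.mul_assoc, k3, Matrix.mul_assoc]

variable (G)

instance unitaryIrrepSetoid : Setoid (UnitaryIrrep G) where
  r := UnitaryIrrep.Equivalent
  iseqv := ⟨UnitaryIrrep.equivalent_refl, UnitaryIrrep.Equivalent.symm,
    UnitaryIrrep.Equivalent.trans⟩

/-- The unitary dual `Ĝ` of a compact group `G`: classes of irreducible unitary representations. -/
def UnitaryDual : Type _ := Quotient (unitaryIrrepSetoid G)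

/-- A choice of a matrix representation in every class of the unitary dual. -/
structure DualSystem where
  rep : UnitaryDual G → UnitaryIrrep G
  rep_mem : ∀ η : UnitaryDual G, (Quotient.mk (unitaryIrrepSetoid G) (rep η)) = η

variable {G}

/-- The dimension `d_η`. -/
def DualSystem.d (S : DualSystem G) (η : UnitaryDual G) : ℕ := (S.rep η).dim

/-- The unitary matrix `η(x)`. -/
def DualSystem.mat (S : DualSystem G) (η : UnitaryDual G) (x : G) :
    Matrix (Fin (S.d η)) (Fin (S.d η)) ℂ := ((S.rep η).toHom x).1

/-- Matrix-valued functions on the time-frequency plane `G × Ĝ` (value at `(x, η)` is `a η x`)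
and on the ambiguity plane `Ĝ × G` (value at `(ξ, y)` is `b ξ y`). -/
abbrev PlaneFun (S : DualSystem G) : Type _ :=
  (η : UnitaryDual G) → G → Matrix (Fin (S.d η)) (Fin (S.d η)) ℂ

end Dual

noncomputable section Transforms

variable {G : Type*} [Group G] [TopologicalSpace G] [MeasurableSpace G]
  (μ : Measure G) (S : DualSystem G)

/-- Entrywise measurability with respect to the group variable. -/
def PlaneMeasurable (a : PlaneFun S) : Prop :=
  ∀ η j k, AEStronglyMeasurable (fun x => a η x j k) μ

/-- The `L²` norm, `‖a‖² = ∑_η d_η ∫ tr (a(x,η) a(x,η)^*) dx`, with values in `[0, ∞]`. -/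
def l2Norm (a : PlaneFun S) : ℝ≥0∞ :=
  (∑' η, (S.d η : ℝ≥0∞) * ∫⁻ x, ∑ j, ∑ k, ‖a η x j k‖ₑ ^ 2 ∂μ) ^ (1 / 2 : ℝ)

/-- Membership in `L²(G × Ĝ)`, or in `L²(Ĝ × G)`. -/
def MemL2 (a : PlaneFun S) : Prop := PlaneMeasurable μ S a ∧ l2Norm μ S a < ∞

/-- The `L^∞` norm, the (essential) supremum of the operator norms `‖φ(ξ,y)‖_op`. -/
def linftyNorm (φ : PlaneFun S) : ℝ≥0∞ :=
  ⨆ ξ, essSup (fun y => ‖Matrix.toEuclideanCLM (n := Fin (S.d ξ)) (𝕜 := ℂ) (φ ξ y)‖ₑ) μ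

/-- The inner product `⟨b, a⟩ = ∑_η d_η ∫ tr (b(x,η) a(x,η)^*) dx`, linear in `b`. -/
def planeInner (b a : PlaneFun S) : ℂ :=
  ∑' η, (S.d η : ℂ) * ∫ x, (b η x * (a η x)ᴴ).trace ∂μ

/-- The Fourier coefficient `v̂(η) = ∫ v(x) η(x)^* dx`. -/
def fourierCoeff (v : G → ℂ) (η : UnitaryDual G) : Matrix (Fin (S.d η)) (Fin (S.d η)) ℂ :=
  Matrix.of fun j k => ∫ x, v x * (S.mat η x)ᴴ j k ∂μ

/-- `(𝓕 ⊗ I) g (ξ, y) = ∫ g(x,y) ξ(x)^* dx`. -/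
def fourierFst (g : G × G → ℂ) : PlaneFun S := fun ξ y => fourierCoeff μ S (fun x => g (x, y)) ξ

/-- `(I ⊗ 𝓕) g (x, η) = ∫ g(x,y) η(y)^* dy`. -/
def fourierSnd (g : G × G → ℂ) : PlaneFun S := fun η x => fourierCoeff μ S (fun y => g (x, y)) η

open Classical in
/-- The class of a square-integrable function in `L²(G × G)` (zero for other functions). -/
def toL2 (f : G × G → ℂ) : Lp ℂ 2 (μ.prod μ) :=
  if h : MemLp f 2 (μ.prod μ) then h.toLp f else 0

/-- The term `(x, y) ↦ d_ξ tr (ξ(x) b(ξ,y))` of the Fourier series in the first variable. -/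
def seriesFst (b : PlaneFun S) (ξ : UnitaryDual G) : Lp ℂ 2 (μ.prod μ) :=
  toL2 μ fun p => (S.d ξ : ℂ) * (S.mat ξ p.1 * b ξ p.2).trace

/-- The term `(x, y) ↦ d_η tr (η(y) a(x,η))` of the Fourier series in the second variable. -/
def seriesSnd (a : PlaneFun S) (η : UnitaryDual G) : Lp ℂ 2 (μ.prod μ) :=
  toL2 μ fun p => (S.d η : ℂ) * (S.mat η p.2 * a η p.1).trace

/-- `(𝓕⁻¹ ⊗ I) b (x, y) = ∫ ξ(x) b(ξ,y) dξ`, the sum being taken in `L²(G × G)`. -/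
def invFourierFst (b : PlaneFun S) : Lp ℂ 2 (μ.prod μ) := ∑' ξ, seriesFst μ S b ξ

/-- `(I ⊗ 𝓕⁻¹) a (x, y) = ∫ η(y) a(x,η) dη`, the sum being taken in `L²(G × G)`. -/
def invFourierSnd (a : PlaneFun S) : Lp ℂ 2 (μ.prod μ) := ∑' η, seriesSnd μ S a η

/-- The symplectic Fourier transform `F a (ξ, y) = ∫ ξ(x)^* ∫ η(y) a(x,η) dη dx`. -/
def sympl (a : PlaneFun S) : PlaneFun S := fourierFst μ S (invFourierSnd μ S a)

/-- The inverse transform `F⁻¹ b (x, η) = ∫ η(y)^* ∫ ξ(x) b(ξ,y) dξ dy`. -/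
def symplInv (b : PlaneFun S) : PlaneFun S := fourierSnd μ S (invFourierFst μ S b)

/-- The Kohn–Nirenberg transform `R(u,v)(x,η) = u(x) η(x)^* v̂(η)^*`. -/
def knTransform (u v : Lp ℂ 2 μ) : PlaneFun S :=
  fun η x => u x • ((S.mat η x)ᴴ * (fourierCoeff μ S v η)ᴴ)

/-- The pointwise product `φ · F R(u,v)` on the ambiguity plane. -/
def ambiguity (φ : PlaneFun S) (u v : Lp ℂ 2 μ) : PlaneFun S :=
  fun ξ y => φ ξ y * sympl μ S (knTransform μ S u v) ξ y

/-- The time-frequency transform `D(u,v) = F⁻¹ (φ · F R(u,v))` with ambiguity kernel `φ`. -/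
def tfTransform (φ : PlaneFun S) (u v : Lp ℂ 2 μ) : PlaneFun S :=
  symplInv μ S (ambiguity μ S φ u v)

/-- `A` is the `D`-pseudo-differential operator `a^D`: `⟨u, A v⟩ = ⟨D(u,v), a⟩` for all `u, v`.
(The inner product `⟨u, w⟩ = ∫ u w^*` is `inner ℂ w u` in Mathlib.) -/
def IsQuantization (φ a : PlaneFun S) (A : Lp ℂ 2 μ → Lp ℂ 2 μ) : Prop :=
  ∀ u v : Lp ℂ 2 μ, inner ℂ (A v) u = planeInner μ S (tfTransform μ S φ u v) a

/-- The term `d_η tr (η(x) a(x,η) v̂(η))` of the Kohn–Nirenberg operator. -/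
def knTerm (a : PlaneFun S) (v : Lp ℂ 2 μ) (x : G) (η : UnitaryDual G) : ℂ :=
  (S.d η : ℂ) * (S.mat η x * a η x * fourierCoeff μ S v η).trace

/-- The Kohn–Nirenberg operator `a^R v (x) = ∫ η(x) a(x,η) v̂(η) dη`. -/
def knOperator (a : PlaneFun S) (v : Lp ℂ 2 μ) : G → ℂ := fun x => ∑' η, knTerm μ S a v x η

end Transforms

end TimeFreq

set_option linter.unusedSectionVars false
set_option linter.overlappingInstances false

/-! Everything rests on Plancherel's formula, here `plancherel`, which is derived from Schur's lemma
and a full proof of the Peter–Weyl theorem. Convolution with a Hermitian continuous kernel is a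
compact symmetric operator on `L²(G)` commuting with right translations. Its eigenspaces for nonzero
eigenvalues are therefore finite-dimensional and translation invariant, so they consist of matrix
coefficients. A vector orthogonal to all coefficients is killed by every such convolution, and
approximate identities force it to vanish.

For (i), `D(u,v)` is obtained from `R(u,v)` by passing to `L²(G × G)` and to the ambiguity plane,
multiplying by the kernel, and passing back. Each partial transform is a contraction. From `G × G`
to a plane this is Plancherel on almost every slice (`planeSq_fourierSnd_le`). In the other
direction the terms of the Fourier series are orthogonal with the right norms, so the series
converges (`MemL2.summable_seriesSnd`). Multiplication by the kernel costs its sup norm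
(`planeSq_kernel_mul_le`). By the adjointness `MemL2.planeInner_fourierSnd`, the pairing of `D(u,v)`
with `a` is a bounded sesquilinear form in `u` and `v`, and Riesz representation yields `a^D`.

For (ii), unitarity of `η(x)` and Plancherel give the norm of `R(u,v)`, and pointwise Cauchy–Schwarz
bounds the series of `a^R v`. The dual may be uncountable, but only the countably many `η` with
`v̂(η) ≠ 0` contribute, so sums and integrals may be exchanged. -/

namespace TimeFreq

/-! ### Unimodularity of compact groups. -/

section Haar

variable {G : Type*} [Group G] [TopologicalSpace G] [IsTopologicalGroup G] [CompactSpace G]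
  [MeasurableSpace G] [BorelSpace G]

/-- A compact group is unimodular: its normalized Haar measure is right invariant. -/
theorem isMulRightInvariant_of_compact (μ : Measure G) [μ.IsHaarMeasure] [IsProbabilityMeasure μ]
    [μ.Regular] : μ.IsMulRightInvariant where
  map_mul_right_eq_self g := by
    -- The right translate of `μ` is still left invariant, so uniqueness of Haar measure leaves only
    -- a scalar, which the total mass fixes as 1.
    have h := Measure.isMulInvariant_eq_smul_of_compactSpace (Measure.map (· * g) μ) μ
    have h1 : Measure.map (· * g) μ Set.univ = 1 := by
      rw [Measure.map_apply (measurable_mul_const g) MeasurableSet.univ]; simp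
    rw [h] at h1
    simp only [Measure.smul_apply, measure_univ] at h1
    rw [h]
    have h2 : Measure.haarScalarFactor (Measure.map (· * g) μ) μ = 1 := by
      simpa [ENNReal.smul_def] using h1
    rw [h2, one_smul]

end Haar

/-! ### Schur's lemma and the orthogonality relations. -/

namespace UnitaryIrrep

variable {G : Type*} [Group G] [TopologicalSpace G]

/-- The unitary matrix `ξ(x)`. -/
abbrev mat (ξ : UnitaryIrrep G) (x : G) : Matrix (Fin ξ.dim) (Fin ξ.dim) ℂ := (ξ.toHom x).1

theorem continuous_mat (ξ : UnitaryIrrep G) : Continuous ξ.mat :=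
  continuous_subtype_val.comp ξ.continuous_toHom

theorem continuous_mat_apply (ξ : UnitaryIrrep G) (i j) : Continuous fun x => ξ.mat x i j :=
  ξ.continuous_mat.matrix_elem i j

theorem mat_mul (ξ : UnitaryIrrep G) (x y : G) : ξ.mat (x * y) = ξ.mat x * ξ.mat y := by
  simp [mat]

theorem conjTranspose_mat_mul_mat (ξ : UnitaryIrrep G) (x : G) : (ξ.mat x)ᴴ * ξ.mat x = 1 :=
  Unitary.star_mul_self_of_mem (ξ.toHom x).2

theorem mat_mul_conjTranspose_mat (ξ : UnitaryIrrep G) (x : G) : ξ.mat x * (ξ.mat x)ᴴ = 1 :=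
  Unitary.mul_star_self_of_mem (ξ.toHom x).2

theorem mat_inv (ξ : UnitaryIrrep G) (x : G) : ξ.mat x⁻¹ = (ξ.mat x)ᴴ := by
  simp only [mat, map_inv]; rfl

/-- **Schur's lemma**: the commutant of an irreducible representation is scalar. -/
theorem eq_smul_one_of_commute (ξ : UnitaryIrrep G) (A : Matrix (Fin ξ.dim) (Fin ξ.dim) ℂ)
    (hA : ∀ x, ξ.mat x * A = A * ξ.mat x) : ∃ c : ℂ, A = c • 1 := by
  have : Nonempty (Fin ξ.dim) := ⟨⟨0, ξ.dim_pos⟩⟩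
  obtain ⟨c, hc⟩ := Module.End.exists_eigenvalue (Matrix.toLin' A)
  refine ⟨c, ?_⟩
  -- An eigenspace of a commuting matrix is invariant; being nonzero, it is the whole space.
  have h := ξ.irreducible (Module.End.eigenspace (Matrix.toLin' A) c) fun x w hw => by
    rw [Module.End.mem_eigenspace_iff] at hw ⊢
    rw [Matrix.toLin'_apply] at hw ⊢
    rw [Matrix.mulVec_mulVec, ← hA, ← Matrix.mulVec_mulVec, hw, Matrix.mulVec_smul]
  have htop := h.resolve_left hc
  apply Matrix.toLin'.injective
  ext1 i
  ext1
  have : ∀ w, Matrix.toLin' A w = c • w := fun w => by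
    rw [← Module.End.mem_eigenspace_iff, htop]; trivial
  simp [this, -Matrix.toLin'_apply]

/-- A nonzero intertwiner between irreducible representations makes them unitarily equivalent. -/
theorem equivalent_of_intertwiner {ξ η : UnitaryIrrep G}
    {A : Matrix (Fin η.dim) (Fin ξ.dim) ℂ} (hA : ∀ x, η.mat x * A = A * ξ.mat x) (h0 : A ≠ 0) :
    ξ.Equivalent η := by
  have hAH : ∀ x, Aᴴ * η.mat x = ξ.mat x * Aᴴ := fun x => by
    have := congrArg Matrix.conjTranspose (hA x⁻¹)
    simpa [mat_inv, Matrix.conjTranspose_mul] using this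
  -- Both `A Aᴴ` and `Aᴴ A` are scalar by Schur's lemma, and computing `A Aᴴ A` in two ways shows
  -- that the scalars agree. A diagonal entry of `A Aᴴ` exhibits the scalar as a real `r ≥ 0`,
  -- nonzero since `A ≠ 0`, so `r^(-1/2) A` is unitary.
  obtain ⟨c, hc⟩ := η.eq_smul_one_of_commute (A * Aᴴ) fun x => by
    rw [← Matrix.mul_assoc, hA, Matrix.mul_assoc, Matrix.mul_assoc, hAH]
  obtain ⟨c', hc'⟩ := ξ.eq_smul_one_of_commute (Aᴴ * A) fun x => by
    rw [← Matrix.mul_assoc, ← hAH, Matrix.mul_assoc, Matrix.mul_assoc, hA]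
  have hcc : c = c' := by
    have h1 : c • A = c' • A := by
      calc c • A = (A * Aᴴ) * A := by rw [hc]; simp
        _ = c' • A := by rw [Matrix.mul_assoc, hc']; simp
    by_contra hne
    apply h0
    have h2 : (c - c') • A = 0 := by rw [sub_smul, h1, sub_self]
    exact (smul_eq_zero.mp h2).resolve_left (sub_ne_zero.mpr hne)
  have hc0 : c ≠ 0 := by
    rintro rfl
    apply h0
    rw [zero_smul] at hc
    open scoped ComplexOrder in
    exact Matrix.self_mul_conjTranspose_eq_zero.mp hc
  obtain ⟨r, hr0, hr⟩ : ∃ r : ℝ, 0 ≤ r ∧ c = r := by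
    refine ⟨∑ k, ‖A ⟨0, η.dim_pos⟩ k‖ ^ 2, by positivity, ?_⟩
    have := congrFun (congrFun hc ⟨0, η.dim_pos⟩) ⟨0, η.dim_pos⟩
    simp only [Matrix.mul_apply, Matrix.conjTranspose_apply, Matrix.smul_apply, Matrix.one_apply_eq,
      smul_eq_mul, mul_one] at this
    rw [← this]
    push_cast
    exact Finset.sum_congr rfl fun k _ => Complex.mul_conj' _
  have hs : ((Real.sqrt r : ℝ) : ℂ) * (Real.sqrt r : ℝ) = c := by
    rw [← Complex.ofReal_mul, Real.mul_self_sqrt hr0, hr]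
  have hs0 : ((Real.sqrt r : ℝ) : ℂ) ≠ 0 := fun h => hc0 (by rw [← hs, h, mul_zero])
  refine ⟨((Real.sqrt r : ℝ) : ℂ)⁻¹ • A, ?_, ?_, fun x => ?_⟩
  · rw [Matrix.conjTranspose_smul, Matrix.smul_mul, Matrix.mul_smul, hc, smul_smul, smul_smul, ← hs]
    simp only [star_inv₀, RCLike.star_def, Complex.conj_ofReal]
    rw [show ((Real.sqrt r : ℝ) : ℂ)⁻¹ * ((Real.sqrt r : ℝ) : ℂ)⁻¹ *
      (((Real.sqrt r : ℝ) : ℂ) * (Real.sqrt r : ℝ)) = 1 by field_simp, one_smul]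
  · rw [Matrix.conjTranspose_smul, Matrix.smul_mul, Matrix.mul_smul, hc', ← hcc, smul_smul,
      smul_smul, ← hs]
    simp only [star_inv₀, RCLike.star_def, Complex.conj_ofReal]
    rw [show ((Real.sqrt r : ℝ) : ℂ)⁻¹ * ((Real.sqrt r : ℝ) : ℂ)⁻¹ *
      (((Real.sqrt r : ℝ) : ℂ) * (Real.sqrt r : ℝ)) = 1 by field_simp, one_smul]
  · rw [Matrix.smul_mul, Matrix.mul_smul]
    exact congrArg _ (hA x).symm

section Orthogonality

variable [IsTopologicalGroup G] [CompactSpace G] [MeasurableSpace G] [BorelSpace G]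
  (μ : Measure G) [μ.IsHaarMeasure] [IsProbabilityMeasure μ]

/-- The average `∫ η(x) B ξ(x)^* dx`. -/
noncomputable def average (η ξ : UnitaryIrrep G) (B : Matrix (Fin η.dim) (Fin ξ.dim) ℂ) :
    Matrix (Fin η.dim) (Fin ξ.dim) ℂ :=
  Matrix.of fun i j => ∫ x, (η.mat x * B * (ξ.mat x)ᴴ) i j ∂μ

theorem integrable_of_continuous {f : G → ℂ} (hf : Continuous f) : Integrable f μ :=
  hf.integrable_of_hasCompactSupport (HasCompactSupport.of_compactSpace f)

theorem continuous_average_integrand (η ξ : UnitaryIrrep G)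
    (B : Matrix (Fin η.dim) (Fin ξ.dim) ℂ) :
    Continuous fun x => η.mat x * B * (ξ.mat x)ᴴ :=
  (η.continuous_mat.matrix_mul continuous_const).matrix_mul
    ξ.continuous_mat.matrix_conjTranspose

/-- By left invariance one may replace `x` by `g x` in the integral on the right; this produces
`η(g)` on the left, and the resulting `ξ(g)ᴴ` cancels `ξ(g)`. -/
theorem average_intertwines (η ξ : UnitaryIrrep G) (B : Matrix (Fin η.dim) (Fin ξ.dim) ℂ) (g : G) :
    η.mat g * average μ η ξ B = average μ η ξ B * ξ.mat g := by
  have hc := continuous_average_integrand η ξ B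
  ext i j
  have h1 : (η.mat g * average μ η ξ B) i j
      = ∫ x, (η.mat g * (η.mat x * B * (ξ.mat x)ᴴ)) i j ∂μ := by
    simp only [Matrix.mul_apply (M := η.mat g), average, Matrix.of_apply]
    rw [integral_finsetSum _ fun k _ => (integrable_of_continuous μ (hc.matrix_elem k j)).const_mul _]
    simp only [integral_const_mul]
  have h2 : (average μ η ξ B * ξ.mat g) i j
      = ∫ x, ((η.mat x * B * (ξ.mat x)ᴴ) * ξ.mat g) i j ∂μ := by
    simp only [Matrix.mul_apply (N := ξ.mat g), average, Matrix.of_apply]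
    rw [integral_finsetSum _ fun k _ => (integrable_of_continuous μ (hc.matrix_elem i k)).mul_const _]
    simp only [integral_mul_const]
  rw [h1, h2, ← integral_mul_left_eq_self
    (fun x => ((η.mat x * B * (ξ.mat x)ᴴ) * ξ.mat g) i j) g]
  congr 1 with x
  rw [mat_mul, mat_mul, Matrix.conjTranspose_mul]
  simp only [Matrix.mul_assoc]
  rw [conjTranspose_mat_mul_mat, Matrix.mul_one]

/-- Averages of matrix units have the integrals of the orthogonality relations as their entries. -/
theorem mat_mul_single_mul (η ξ : UnitaryIrrep G) (p : Fin η.dim) (q : Fin ξ.dim) (x : G) (i j) :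
    (η.mat x * Matrix.single p q (1 : ℂ) * (ξ.mat x)ᴴ) i j = η.mat x i p * star (ξ.mat x j q) := by
  rw [Matrix.mul_apply, Finset.sum_eq_single q]
  · simp
  · intro b _ hb
    simp [hb]
  · simp

/-- **Schur orthogonality** for inequivalent representations. -/
theorem integral_mat_mul_star_of_not_equivalent {η ξ : UnitaryIrrep G} (h : ¬ ξ.Equivalent η)
    (i p : Fin η.dim) (j q : Fin ξ.dim) : ∫ x, η.mat x i p * star (ξ.mat x j q) ∂μ = 0 := by
  have h0 : average μ η ξ (Matrix.single p q 1) = 0 := by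
    by_contra h0
    exact h (equivalent_of_intertwiner (average_intertwines μ η ξ _) h0)
  have := congrFun (congrFun h0 i) j
  simpa only [average, Matrix.of_apply, mat_mul_single_mul, Matrix.zero_apply] using this

/-- **Schur orthogonality** for the coefficients of one representation. -/
theorem integral_mat_mul_star_self (ξ : UnitaryIrrep G) (i p j q : Fin ξ.dim) :
    ∫ x, ξ.mat x i p * star (ξ.mat x j q) ∂μ = if i = j ∧ p = q then (ξ.dim : ℂ)⁻¹ else 0 := by
  obtain ⟨c, hc⟩ := ξ.eq_smul_one_of_commute (average μ ξ ξ (Matrix.single p q 1))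
    (average_intertwines μ ξ ξ _)
  have hd : (ξ.dim : ℂ) ≠ 0 := by exact_mod_cast ξ.dim_pos.ne'
  -- Conjugation by a unitary preserves the trace, so the average has the trace of the matrix unit;
  -- this determines the scalar `c`.
  have ht : c * ξ.dim = if p = q then 1 else 0 := by
    have h1 : (average μ ξ ξ (Matrix.single p q 1)).trace
        = ∫ x, (ξ.mat x * Matrix.single p q 1 * (ξ.mat x)ᴴ).trace ∂μ := by
      simp only [Matrix.trace, Matrix.diag_apply, average, Matrix.of_apply]
      rw [integral_finsetSum _ fun k _ => integrable_of_continuous μ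
        ((continuous_average_integrand ξ ξ _).matrix_elem k k)]
    have h2 : ∀ x, (ξ.mat x * Matrix.single p q (1 : ℂ) * (ξ.mat x)ᴴ).trace
        = if p = q then 1 else 0 := fun x => by
      rw [Matrix.trace_mul_comm, ← Matrix.mul_assoc, conjTranspose_mat_mul_mat, Matrix.one_mul]
      split_ifs with h
      · subst h; simp
      · exact Matrix.trace_single_eq_of_ne _ _ _ h
    rw [hc] at h1
    simpa [h2] using h1
  have hij := congrFun (congrFun hc i) j
  simp only [average, Matrix.of_apply, mat_mul_single_mul, Matrix.smul_apply, smul_eq_mul] at hij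
  rw [hij, Matrix.one_apply]
  have hcv : c = (if p = q then 1 else 0) * (ξ.dim : ℂ)⁻¹ := by
    rw [← ht, mul_assoc, mul_inv_cancel₀ hd, mul_one]
  rw [hcv]
  by_cases h1 : i = j <;> by_cases h2 : p = q <;> simp [h1, h2]

end Orthogonality

end UnitaryIrrep

/-! ### Compactness of integral operators with continuous kernel. -/

section InnerTransform

variable {X H : Type*} [TopologicalSpace X] [CompactSpace X] [NormedAddCommGroup H]
  [InnerProductSpace ℂ H]

/-- The operator `f ↦ (x ↦ ⟪K x, f⟫)` with values in the continuous functions. -/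
noncomputable def innerTransform (K : C(X, H)) : H →L[ℂ] C(X, ℂ) :=
  LinearMap.mkContinuous
    { toFun := fun f => ⟨fun x => inner ℂ (K x) f, K.continuous.inner continuous_const⟩
      map_add' := fun f g => by ext x; simp
      map_smul' := fun c f => by ext x; simp } ‖K‖ fun f => by
    rw [ContinuousMap.norm_le _ (by positivity)]
    intro x
    exact (norm_inner_le_norm _ _).trans (by gcongr; exact K.norm_coe_le_norm x)

/-- Arzelà–Ascoli: the images of the unit ball are bounded by `‖K‖`, and by Cauchy–Schwarz they
inherit the modulus of continuity of `K`, uniformly in `f`. -/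
theorem isCompactOperator_innerTransform (K : C(X, H)) : IsCompactOperator (innerTransform K) := by
  let A : Set (BoundedContinuousFunction X ℂ) :=
    (fun f => BoundedContinuousFunction.mkOfCompact (innerTransform K f)) '' Metric.closedBall 0 1
  have hA : IsCompact (closure A) := by
    refine BoundedContinuousFunction.arzela_ascoli (Metric.closedBall 0 ‖K‖)
      (isCompact_closedBall _ _) A ?_ ?_
    · rintro _ x ⟨f, hf, rfl⟩
      rw [mem_closedBall_zero_iff] at hf ⊢
      calc ‖inner ℂ (K x) f‖ ≤ ‖K x‖ * ‖f‖ := norm_inner_le_norm _ _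
        _ ≤ ‖K‖ * 1 := by gcongr; exact K.norm_coe_le_norm x
        _ = ‖K‖ := mul_one _
    · intro x₀
      rw [Metric.equicontinuousAt_iff_right]
      intro ε hε
      have := Metric.continuousAt_iff'.mp (K.continuous.continuousAt (x := x₀)) ε hε
      filter_upwards [this] with x hx
      rintro ⟨_, f, hf, rfl⟩
      rw [mem_closedBall_zero_iff] at hf
      rw [dist_comm, dist_eq_norm]
      change ‖inner ℂ (K x) f - inner ℂ (K x₀) f‖ < ε
      rw [← inner_sub_left]
      calc ‖inner ℂ (K x - K x₀) f‖ ≤ ‖K x - K x₀‖ * ‖f‖ := norm_inner_le_norm _ _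
        _ ≤ ‖K x - K x₀‖ * 1 := by gcongr
        _ < ε := by rwa [mul_one, ← dist_eq_norm]
  let e := (ContinuousMap.isometryEquivBoundedOfCompact X ℂ).symm
  refine ⟨e '' closure A, hA.image e.continuous, ?_⟩
  refine Filter.mem_of_superset (Metric.closedBall_mem_nhds (0 : H) one_pos) fun f hf => ?_
  exact ⟨_, subset_closure ⟨f, hf, rfl⟩, by ext; rfl⟩

end InnerTransform

/-! ### Finite-dimensional translation invariant spaces consist of matrix coefficients. -/

section Translation

variable {G : Type*} [Group G] [TopologicalSpace G] [IsTopologicalGroup G] [CompactSpace G]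

/-- Right translation `(R_g f)(x) = f(xg)`. -/
noncomputable def rightTranslate (g : G) : C(G, ℂ) →ₗ[ℂ] C(G, ℂ) where
  toFun f := ⟨fun x => f (x * g), by fun_prop⟩
  map_add' _ _ := rfl
  map_smul' _ _ := rfl

@[simp]
theorem rightTranslate_apply (g : G) (f : C(G, ℂ)) (x : G) : rightTranslate g f x = f (x * g) := rfl

theorem rightTranslate_mul (g h : G) (f : C(G, ℂ)) :
    rightTranslate (g * h) f = rightTranslate g (rightTranslate h f) := by
  ext x; simp [mul_assoc]

theorem rightTranslate_one (f : C(G, ℂ)) : rightTranslate 1 f = f := by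
  ext x; simp

theorem continuous_rightTranslate (f : C(G, ℂ)) : Continuous fun g => rightTranslate g f :=
  (ContinuousMap.curry ⟨fun p : G × G => f (p.2 * p.1), by fun_prop⟩).continuous

/-- Invariance of a space of continuous functions under right translations. -/
def IsTranslationInvariant (E : Submodule ℂ C(G, ℂ)) : Prop :=
  ∀ g, ∀ f ∈ E, rightTranslate g f ∈ E

/-- Take a nonzero invariant subspace of least dimension. -/
theorem exists_minimal_invariant {E : Submodule ℂ C(G, ℂ)} [FiniteDimensional ℂ E]
    (hE : IsTranslationInvariant E) (h0 : E ≠ ⊥) :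
    ∃ V ≤ E, V ≠ ⊥ ∧ IsTranslationInvariant V ∧
      ∀ U ≤ V, IsTranslationInvariant U → U = ⊥ ∨ U = V := by
  classical
  have hex : ∃ n, ∃ V ≤ E, V ≠ ⊥ ∧ IsTranslationInvariant V ∧ Module.finrank ℂ V = n :=
    ⟨_, E, le_rfl, h0, hE, rfl⟩
  obtain ⟨V, hVE, hV0, hV, hn⟩ := Nat.find_spec hex
  refine ⟨V, hVE, hV0, hV, fun U hU hUi => or_iff_not_imp_left.mpr fun hU0 => ?_⟩
  have : FiniteDimensional ℂ V := Submodule.finiteDimensional_of_le hVE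
  apply Submodule.eq_of_le_of_finrank_le hU
  rw [hn]
  exact Nat.find_min' hex ⟨U, hU.trans hVE, hU0, hUi, rfl⟩

/-- A coefficient function `x ↦ ξ(x)_{ij}`. -/
noncomputable def UnitaryIrrep.coeff (ξ : UnitaryIrrep G) (i j : Fin ξ.dim) : C(G, ℂ) :=
  ⟨fun x => ξ.mat x i j, ξ.continuous_mat_apply i j⟩

/-- The span of the coefficients of the irreducible unitary representations. -/
noncomputable def representative (G : Type*) [Group G] [TopologicalSpace G] [IsTopologicalGroup G]
    [CompactSpace G] : Submodule ℂ C(G, ℂ) :=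
  Submodule.span ℂ {f | ∃ (ξ : UnitaryIrrep G) (i j : Fin ξ.dim), f = ξ.coeff i j}

theorem rightTranslate_coeff (ξ : UnitaryIrrep G) (i j : Fin ξ.dim) (g : G) :
    rightTranslate g (ξ.coeff i j) = ∑ k, ξ.mat g k j • ξ.coeff i k := by
  ext x
  simp only [rightTranslate_apply, UnitaryIrrep.coeff, ContinuousMap.coe_mk, UnitaryIrrep.mat_mul,
    Matrix.mul_apply, ContinuousMap.coe_sum, ContinuousMap.coe_smul, Finset.sum_apply, Pi.smul_apply,
    smul_eq_mul]
  exact Finset.sum_congr rfl fun k _ => mul_comm _ _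

theorem isTranslationInvariant_representative : IsTranslationInvariant (representative G) := by
  intro g f hf
  have : representative G ≤ (representative G).comap (rightTranslate g) := by
    refine Submodule.span_le.mpr ?_
    rintro _ ⟨ξ, i, j, rfl⟩
    simp only [Submodule.comap_coe, Set.mem_preimage, SetLike.mem_coe, rightTranslate_coeff]
    exact Submodule.sum_mem _ fun k _ => Submodule.smul_mem _ _ (Submodule.subset_span ⟨ξ, i, k, rfl⟩)
  exact this hf

section L2

variable [T2Space G] [MeasurableSpace G] [BorelSpace G]
  (μ : Measure G) [μ.IsHaarMeasure] [IsProbabilityMeasure μ] [μ.Regular]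

/-- The class in `L²(G)` of a continuous function. -/
noncomputable abbrev embL2 : C(G, ℂ) →L[ℂ] Lp ℂ 2 μ := ContinuousMap.toLp 2 μ ℂ

theorem embL2_injective : Function.Injective (embL2 μ) := ContinuousMap.toLp_injective μ

theorem inner_embL2 (f : C(G, ℂ)) (u : Lp ℂ 2 μ) :
    inner ℂ (embL2 μ f) u = ∫ x, u x * star (f x) ∂μ := by
  rw [L2.inner_def]
  refine integral_congr_ae ?_
  filter_upwards [ContinuousMap.coeFn_toLp (p := 2) (𝕜 := ℂ) μ f] with x hx
  rw [hx]; rfl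

theorem inner_embL2_embL2 (f h : C(G, ℂ)) :
    inner ℂ (embL2 μ f) (embL2 μ h) = ∫ x, h x * star (f x) ∂μ :=
  ContinuousMap.inner_toLp μ f h

/-- Unimodularity enters here: right translations are unitary, which makes the matrices built below
unitary and orthogonal complements invariant. -/
theorem inner_rightTranslate (g : G) (f h : C(G, ℂ)) :
    inner ℂ (embL2 μ (rightTranslate g f)) (embL2 μ (rightTranslate g h))
      = inner ℂ (embL2 μ f) (embL2 μ h) := by
  have := isMulRightInvariant_of_compact μ
  rw [inner_embL2_embL2, inner_embL2_embL2]
  exact integral_mul_right_eq_self (fun x => h x * star (f x)) g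

/-- An irreducible finite-dimensional translation invariant space of continuous functions consists
of representative functions. -/
theorem le_representative_of_irreducible (μ : Measure G) [μ.IsHaarMeasure] [IsProbabilityMeasure μ]
    [μ.Regular] {V : Submodule ℂ C(G, ℂ)} [FiniteDimensional ℂ V]
    (hV : IsTranslationInvariant V) (h0 : V ≠ ⊥)
    (hirr : ∀ U ≤ V, IsTranslationInvariant U → U = ⊥ ∨ U = V) : V ≤ representative G := by
  classical
  -- An orthonormal basis of the image of `V` in `L²(G)` is pulled back to a basis `b` of continuous
  -- functions.
  let V' : Submodule ℂ (Lp ℂ 2 μ) := V.map (embL2 μ).toLinearMap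
  let n := Module.finrank ℂ V'
  let o : OrthonormalBasis (Fin n) ℂ V' := stdOrthonormalBasis ℂ V'
  let e : V ≃ₗ[ℂ] V' := Submodule.equivMapOfInjective _ (embL2_injective μ) V
  let b : Module.Basis (Fin n) ℂ V := o.toBasis.map e.symm
  have hb : ∀ i, embL2 μ (b i) = (o i : Lp ℂ 2 μ) := fun i => by
    have : e (b i) = o i := by simp [b]
    rw [← this]; rfl
  have horth : ∀ i j, inner ℂ (embL2 μ (b i)) (embL2 μ (b j)) = if i = j then (1 : ℂ) else 0 := by
    intro i j
    rw [hb, hb]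
    exact orthonormal_iff_ite.mp o.orthonormal i j
  have hn : 0 < n := by
    rw [Module.finrank_pos_iff, ← e.toEquiv.nontrivial_congr]
    exact Submodule.nontrivial_iff_ne_bot.mpr h0
  let Φ : (Fin n → ℂ) →ₗ[ℂ] C(G, ℂ) := V.subtype ∘ₗ b.equivFun.symm.toLinearMap
  have hΦ : ∀ w, Φ w = ∑ i, w i • (b i : C(G, ℂ)) := fun w => by
    simp [Φ, Module.Basis.equivFun_symm_apply]
  have hΦinj : Function.Injective Φ := V.injective_subtype.comp b.equivFun.symm.injective
  have hΦV : ∀ w, Φ w ∈ V := fun w => (b.equivFun.symm w).2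
  have hΦsurj : ∀ f ∈ V, ∃ w, Φ w = f := fun f hf => ⟨b.equivFun ⟨f, hf⟩, by simp [Φ]⟩
  have hinner : ∀ w i, inner ℂ (embL2 μ (b i)) (embL2 μ (Φ w)) = w i := fun w i => by
    rw [hΦ, map_sum, inner_sum]
    simp only [map_smul, inner_smul_right, horth]
    simp
  -- The matrix of right translation in the basis `b`; `Φ` intertwines it with right translation,
  -- and irreducibility of `ρ` is the minimality of `V`.
  let ρ : G → Matrix (Fin n) (Fin n) ℂ := fun g => Matrix.of fun i j =>
    inner ℂ (embL2 μ (b i)) (embL2 μ (rightTranslate g (b j)))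
  have hρ : ∀ g w, rightTranslate g (Φ w) = Φ (ρ g *ᵥ w) := fun g w => by
    obtain ⟨w', hw'⟩ := hΦsurj _ (hV g _ (hΦV w))
    rw [← hw']
    congr 1
    ext i
    rw [← hinner w' i, hw', hΦ, map_sum, map_sum, inner_sum]
    simp only [map_smul, inner_smul_right, Matrix.mulVec, dotProduct, ρ, Matrix.of_apply]
    exact Finset.sum_congr rfl fun j _ => mul_comm _ _
  have hmat : ∀ A B : Matrix (Fin n) (Fin n) ℂ, (∀ w, Φ (A *ᵥ w) = Φ (B *ᵥ w)) → A = B :=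
    fun A B h => Matrix.toLin'.injective (LinearMap.ext fun w => hΦinj (by simpa using h w))
  have hmul : ∀ g h, ρ (g * h) = ρ g * ρ h := fun g h => hmat _ _ fun w => by
    rw [← hρ, rightTranslate_mul, hρ, hρ, Matrix.mulVec_mulVec]
  have hone : ρ 1 = 1 := hmat _ _ fun w => by rw [← hρ, rightTranslate_one, Matrix.one_mulVec]
  have hbΦ : ∀ j, (b j : C(G, ℂ)) = Φ (Pi.single j 1) := fun j => by simp [Φ]
  have hunit : ∀ g, (ρ g)ᴴ * ρ g = 1 := fun g => by
    ext i j
    have h1 := inner_rightTranslate μ g (b i) (b j)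
    rw [horth, hbΦ i, hbΦ j, hρ, hρ, hΦ (ρ g *ᵥ Pi.single i 1), map_sum, sum_inner] at h1
    simp only [map_smul, inner_smul_left, hinner] at h1
    rw [Matrix.one_apply, ← h1, Matrix.mul_apply]
    simp
  have hcont : Continuous ρ := by
    refine continuous_matrix fun i j => ?_
    exact continuous_const.inner ((embL2 μ).continuous.comp (continuous_rightTranslate _))
  let ξ : UnitaryIrrep G :=
    { dim := n
      dim_pos := hn
      toHom :=
        { toFun := fun g => ⟨ρ g, Matrix.mem_unitaryGroup_iff'.mpr (hunit g)⟩
          map_one' := Subtype.ext hone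
          map_mul' := fun g h => Subtype.ext (hmul g h) }
      continuous_toHom := hcont.subtype_mk _
      irreducible := fun W hW => by
        have hU := hirr (W.map Φ) (by rintro _ ⟨w, -, rfl⟩; exact hΦV w) (by
          rintro g _ ⟨w, hw, rfl⟩
          rw [hρ]
          exact ⟨_, hW g w hw, rfl⟩)
        refine hU.imp (fun h => ?_) fun h => ?_
        · rw [eq_bot_iff]
          intro w hw
          have : Φ w ∈ W.map Φ := ⟨w, hw, rfl⟩
          rw [h, Submodule.mem_bot] at this
          exact hΦinj (this.trans (map_zero Φ).symm)
        · rw [eq_top_iff]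
          rintro w -
          have : Φ w ∈ W.map Φ := h ▸ hΦV w
          obtain ⟨w', hw', hw⟩ := this
          exact hΦinj hw ▸ hw' }
  intro f hf
  obtain ⟨w, rfl⟩ := hΦsurj f hf
  -- Every function satisfies `f(g) = (R_g f)(1)`; expanding `R_g f` in the basis expresses `f`
  -- through the entries of `ρ(g)`, weighted by the values of the basis at 1.
  have hfin : Φ w = ∑ i, ∑ j, ((b i : C(G, ℂ)) 1 * w j) • ξ.coeff i j := by
    ext g
    have h1 : Φ w g = rightTranslate g (Φ w) 1 := by simp
    rw [h1, hρ, hΦ]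
    simp only [ContinuousMap.coe_sum, ContinuousMap.coe_smul, Finset.sum_apply, Pi.smul_apply,
      smul_eq_mul, Matrix.mulVec, dotProduct, Finset.sum_mul]
    refine Finset.sum_congr rfl fun i _ => Finset.sum_congr rfl fun j _ => ?_
    change ρ g i j * w j * _ = _ * ρ g i j
    ring
  rw [hfin]
  exact Submodule.sum_mem _ fun i _ => Submodule.sum_mem _ fun j _ =>
    Submodule.smul_mem _ _ (Submodule.subset_span ⟨ξ, i, j, rfl⟩)

/-- Finite-dimensional translation invariant spaces consist of representative functions. -/
theorem le_representative_of_finiteDimensional (μ : Measure G) [μ.IsHaarMeasure] [IsProbabilityMeasure μ]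
    [μ.Regular] {E : Submodule ℂ C(G, ℂ)} [FiniteDimensional ℂ E]
    (hE : IsTranslationInvariant E) : E ≤ representative G := by
  let N := E ⊓ representative G
  let N' : Submodule ℂ (Lp ℂ 2 μ) := N.map (embL2 μ).toLinearMap
  have : FiniteDimensional ℂ N := Submodule.finiteDimensional_of_le inf_le_left
  -- The complement in `E` of its representative part is invariant. If it were nonzero, a minimal
  -- invariant subspace of it would be representative, hence orthogonal to itself.
  let W : Submodule ℂ C(G, ℂ) := E ⊓ N'ᗮ.comap (embL2 μ).toLinearMap
  have : FiniteDimensional ℂ W := Submodule.finiteDimensional_of_le inf_le_left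
  have hN : IsTranslationInvariant N := fun g f hf =>
    ⟨hE g f hf.1, isTranslationInvariant_representative g f hf.2⟩
  have hW : IsTranslationInvariant W := by
    rintro g f ⟨hfE, hfN⟩
    refine ⟨hE g f hfE, ?_⟩
    simp only [Submodule.comap_coe, Set.mem_preimage, SetLike.mem_coe,
      Submodule.mem_orthogonal] at hfN ⊢
    rintro _ ⟨h, hh, rfl⟩
    have h1 := inner_rightTranslate μ g (rightTranslate g⁻¹ h) f
    rw [← rightTranslate_mul, mul_inv_cancel, rightTranslate_one] at h1
    exact h1.trans (hfN _ ⟨_, hN g⁻¹ h hh, rfl⟩)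
  have hW0 : W = ⊥ := by
    by_contra hne
    obtain ⟨V, hVW, hV0, hV, hirr⟩ := exists_minimal_invariant hW hne
    have : FiniteDimensional ℂ V := Submodule.finiteDimensional_of_le hVW
    have hVr := le_representative_of_irreducible μ hV hV0 hirr
    apply hV0
    rw [eq_bot_iff]
    intro f hf
    have hfN : embL2 μ f ∈ N' := ⟨f, ⟨(hVW hf).1, hVr hf⟩, rfl⟩
    have hz := (hVW hf).2 (embL2 μ f) hfN
    have hz' : embL2 μ f = embL2 μ 0 := by
      rw [map_zero]; exact inner_self_eq_zero.mp hz
    exact embL2_injective μ hz'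
  intro f hf
  obtain ⟨h, hh, hp⟩ := (N'.starProjection_apply_mem (embL2 μ f) : _ ∈ N')
  have hp' : embL2 μ h = N'.starProjection (embL2 μ f) := hp
  have hd : f - h ∈ W := by
    refine ⟨E.sub_mem hf hh.1, ?_⟩
    change embL2 μ (f - h) ∈ N'ᗮ
    rw [map_sub, hp']
    exact Submodule.sub_starProjection_mem_orthogonal _
  rw [hW0, Submodule.mem_bot, sub_eq_zero] at hd
  exact hd ▸ hh.2

end L2

end Translation

/-! ### Convolution operators and the Peter–Weyl theorem. -/

section Convolution

variable {G : Type*} [Group G] [TopologicalSpace G] [IsTopologicalGroup G] [CompactSpace G]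
  [T2Space G] [MeasurableSpace G] [BorelSpace G]
  (μ : Measure G) [μ.IsHaarMeasure] [IsProbabilityMeasure μ] [μ.Regular] (k : C(G, ℂ))

/-- The function `y ↦ k(y x⁻¹)`. -/
noncomputable def shiftKernel (k : C(G, ℂ)) : C(G, C(G, ℂ)) :=
  ContinuousMap.curry ⟨fun p : G × G => k (p.2 * p.1⁻¹), by fun_prop⟩

/-- The convolution operator `f ↦ (x ↦ ∫ f(y) k(y x⁻¹)^* dy)` from `L²(G)` to `C(G)`. -/
noncomputable def convC : Lp ℂ 2 μ →L[ℂ] C(G, ℂ) :=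
  innerTransform ⟨fun x => embL2 μ (shiftKernel k x),
    (embL2 μ).continuous.comp (shiftKernel k).continuous⟩

theorem convC_apply (f : Lp ℂ 2 μ) (x : G) :
    convC μ k f x = inner ℂ (embL2 μ (shiftKernel k x)) f := rfl

theorem convC_embL2 (f : C(G, ℂ)) (x : G) :
    convC μ k (embL2 μ f) x = ∫ y, f y * star (k (y * x⁻¹)) ∂μ := by
  rw [convC_apply, inner_embL2_embL2]; rfl

/-- The kernel depends only on `y x⁻¹`, which is unchanged when `x` and `y` are both multiplied by
`g` on the right. This makes the eigenspaces translation invariant. -/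
theorem convC_rightTranslate (f : C(G, ℂ)) (g : G) :
    convC μ k (embL2 μ (rightTranslate g f)) = rightTranslate g (convC μ k (embL2 μ f)) := by
  have := isMulRightInvariant_of_compact μ
  ext x
  rw [rightTranslate_apply, convC_embL2, convC_embL2,
    ← integral_mul_right_eq_self (fun y => f y * star (k (y * (x * g)⁻¹))) g]
  congr 1 with y
  simp [mul_assoc]

/-- The convolution operator on `L²(G)`. -/
noncomputable def convL2 : Lp ℂ 2 μ →L[ℂ] Lp ℂ 2 μ := embL2 μ ∘L convC μ k

theorem convL2_apply (f : Lp ℂ 2 μ) : convL2 μ k f = embL2 μ (convC μ k f) := rfl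

theorem isCompactOperator_convL2 : IsCompactOperator (convL2 μ k) :=
  (isCompactOperator_innerTransform _).clm_comp (embL2 μ)

theorem denseRange_embL2 : DenseRange (embL2 μ) :=
  ContinuousMap.toLp_denseRange ℂ μ ℂ (by norm_num)

variable {k}

/-- The condition on `k` says that the kernel `k(y x⁻¹)` is Hermitian; the rest is Fubini for
continuous functions. -/
theorem inner_convL2_embL2 (hk : ∀ g, k g⁻¹ = star (k g)) (f h : C(G, ℂ)) :
    inner ℂ (convL2 μ k (embL2 μ f)) (embL2 μ h)
      = inner ℂ (embL2 μ f) (convL2 μ k (embL2 μ h)) := by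
  rw [convL2_apply, convL2_apply, inner_embL2_embL2, inner_embL2_embL2]
  simp only [convC_embL2]
  have h1 : ∀ x, h x * star (∫ y, f y * star (k (y * x⁻¹)) ∂μ)
      = ∫ y, h x * star (f y) * k (y * x⁻¹) ∂μ := fun x => by
    rw [RCLike.star_def, ← integral_conj, ← integral_const_mul]
    congr 1 with y
    simp [mul_assoc]
  have h2 : ∀ y, (∫ x, h x * star (k (x * y⁻¹)) ∂μ) * star (f y)
      = ∫ x, h x * star (f y) * k (y * x⁻¹) ∂μ := fun y => by
    rw [← integral_mul_const]
    congr 1 with x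
    rw [← hk]
    simp only [mul_inv_rev, inv_inv]
    ring
  simp only [h1, h2]
  exact integral_integral_swap_of_hasCompactSupport
    (f := fun x y => h x * star (f y) * k (y * x⁻¹))
    (by simp only [Function.uncurry_def]; fun_prop) (HasCompactSupport.of_compactSpace _)

theorem isSymmetric_convL2 (hk : ∀ g, k g⁻¹ = star (k g)) :
    (convL2 μ k : Lp ℂ 2 μ →ₗ[ℂ] Lp ℂ 2 μ).IsSymmetric := by
  intro u v
  refine (denseRange_embL2 μ).induction_on (p := fun u => inner ℂ (convL2 μ k u) v
    = inner ℂ u (convL2 μ k v)) u (isClosed_eq (by fun_prop) (by fun_prop)) fun f => ?_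
  exact (denseRange_embL2 μ).induction_on (p := fun v => inner ℂ (convL2 μ k (embL2 μ f)) v
    = inner ℂ (embL2 μ f) (convL2 μ k v)) v (isClosed_eq (by fun_prop) (by fun_prop))
    fun h => inner_convL2_embL2 μ hk f h

/-- An eigenvector of a convolution operator for a nonzero eigenvalue is representative. -/
theorem mem_of_convL2_eq_smul {c : ℂ} (hc : c ≠ 0) {f : Lp ℂ 2 μ}
    (hf : convL2 μ k f = c • f) : ∃ h ∈ representative G, embL2 μ h = f := by
  let A : C(G, ℂ) →ₗ[ℂ] C(G, ℂ) := (convC μ k ∘L embL2 μ).toLinearMap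
  let E : Submodule ℂ C(G, ℂ) := Module.End.eigenspace A c
  have hE : ∀ h, h ∈ E ↔ convC μ k (embL2 μ h) = c • h := fun h => Module.End.mem_eigenspace_iff
  have hinv : IsTranslationInvariant E := fun g h hh => by
    rw [hE] at hh ⊢
    rw [convC_rightTranslate, hh, map_smul]
  have hfin : FiniteDimensional ℂ
      (Module.End.eigenspace (convL2 μ k : Lp ℂ 2 μ →ₗ[ℂ] Lp ℂ 2 μ) c) :=
    ContinuousLinearMap.finite_dimensional_eigenspace (isCompactOperator_convL2 μ k) c hc
  have hmaps : ∀ h ∈ E, embL2 μ h ∈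
      Module.End.eigenspace (convL2 μ k : Lp ℂ 2 μ →ₗ[ℂ] Lp ℂ 2 μ) c := fun h hh => by
    rw [Module.End.mem_eigenspace_iff]
    change embL2 μ (convC μ k (embL2 μ h)) = _
    rw [(hE h).mp hh, map_smul]
  have : FiniteDimensional ℂ E :=
    FiniteDimensional.of_injective ((embL2 μ).toLinearMap.restrict hmaps) fun a b hab =>
      Subtype.ext (embL2_injective μ (congrArg Subtype.val hab))
  -- Since `f` is `c⁻¹` times its convolution, it has a continuous version, and this version lies in
  -- the finite-dimensional invariant space `E`.
  refine ⟨c⁻¹ • convC μ k f, le_representative_of_finiteDimensional μ hinv ?_, ?_⟩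
  · have hemb : embL2 μ (c⁻¹ • convC μ k f) = f := by
      rw [map_smul, ← convL2_apply, hf, inv_smul_smul₀ hc]
    rw [hE, hemb, smul_inv_smul₀ hc]
  · rw [map_smul, ← convL2_apply, hf, inv_smul_smul₀ hc]

/-- A function orthogonal to the representative functions is annihilated by convolutions. -/
theorem convL2_eq_zero_of_orthogonal (hk : ∀ g, k g⁻¹ = star (k g)) {u : Lp ℂ 2 μ}
    (hu : ∀ h ∈ representative G, inner ℂ (embL2 μ h) u = 0) : convL2 μ k u = 0 := by
  have hbot := ContinuousLinearMap.orthogonalComplement_iSup_eigenspaces_eq_bot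
    (isCompactOperator_convL2 μ k) (isSymmetric_convL2 μ hk)
  -- By the spectral theorem it is enough to test against eigenvectors `f`. By symmetry the pairing
  -- is `⟨convL2 f, u⟩`: zero if the eigenvalue is 0, and otherwise zero because `f` is
  -- representative.
  have : convL2 μ k u ∈ (⨆ c, Module.End.eigenspace
      (convL2 μ k : Lp ℂ 2 μ →ₗ[ℂ] Lp ℂ 2 μ) c)ᗮ := by
    rw [← Submodule.iInf_orthogonal, Submodule.mem_iInf]
    intro c f hf
    rw [Module.End.mem_eigenspace_iff] at hf
    have h1 : inner ℂ (convL2 μ k f) u = inner ℂ f (convL2 μ k u) := isSymmetric_convL2 μ hk f u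
    rw [← h1]
    change convL2 μ k f = c • f at hf
    by_cases hc : c = 0
    · rw [hf, hc, zero_smul, inner_zero_left]
    · obtain ⟨h, hh, rfl⟩ := mem_of_convL2_eq_smul μ hc hf
      rw [hf, inner_smul_left, hu h hh, mul_zero]
  rwa [hbot, Submodule.mem_bot] at this

/-- Approximation of a continuous function by its convolutions with a bump function. -/
theorem exists_kernel_norm_sub_le (f : C(G, ℂ)) {ε : ℝ} (hε : 0 < ε) :
    ∃ k : C(G, ℂ), (∀ g, k g⁻¹ = star (k g)) ∧ ∃ c : ℝ, 0 < c ∧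
      ‖convC μ k (embL2 μ f) - (c : ℂ) • f‖ ≤ ε * c := by
  have := isMulRightInvariant_of_compact μ
  -- Continuity at 1 of `g ↦ f(g ·)` in the sup norm expresses uniform continuity of `f`, since `F
  -- (y x⁻¹) x = f y`.
  let F : C(G, C(G, ℂ)) := ContinuousMap.curry ⟨fun p : G × G => f (p.1 * p.2), by fun_prop⟩
  have hF1 : F 1 = f := by ext x; simp [F]
  let U : Set G := {g | ‖F g - f‖ < ε}
  have hU : IsOpen U := isOpen_lt (by fun_prop) continuous_const
  have h1U : (1 : G) ∈ U := by simp [U, hF1, hε]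
  obtain ⟨b, hb0, hb1, hb01⟩ := exists_continuous_zero_one_of_isClosed hU.isClosed_compl
    isClosed_singleton (Set.disjoint_singleton_right.mpr fun h => h h1U)
  -- Multiplying the bump by its reflection makes the kernel invariant under inversion. It is not
  -- normalized: its mass is the factor `c`.
  let r : C(G, ℝ) := ⟨fun g => b g * b g⁻¹, by fun_prop⟩
  have hr0 : ∀ g, 0 ≤ r g := fun g => mul_nonneg (hb01 g).1 (hb01 g⁻¹).1
  have hr1 : r 1 ≠ 0 := by simp [r, hb1 rfl]
  have hrU : ∀ g, g ∉ U → r g = 0 := fun g hg => by simp [r, hb0 hg]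
  have hrinv : ∀ g, r g⁻¹ = r g := fun g => by simp [r, mul_comm]
  have hpos : 0 < ∫ g, r g ∂μ := r.continuous.integral_pos_of_hasCompactSupport_nonneg_nonzero
    (HasCompactSupport.of_compactSpace _) hr0 hr1
  have hrint : ∀ x, Integrable (fun y => r (y * x⁻¹)) μ := fun x =>
    Continuous.integrable_of_hasCompactSupport (by fun_prop) (HasCompactSupport.of_compactSpace _)
  refine ⟨⟨fun g => (r g : ℂ), by fun_prop⟩, fun g => by simp [hrinv], ∫ g, r g ∂μ, hpos, ?_⟩
  rw [ContinuousMap.norm_le _ (by positivity)]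
  intro x
  have hc : ((∫ g, r g ∂μ : ℝ) : ℂ) * f x = ∫ y, f x * (r (y * x⁻¹) : ℂ) ∂μ := by
    rw [integral_const_mul, integral_complex_ofReal, integral_mul_right_eq_self (fun y => r y) x⁻¹, mul_comm]
  rw [ContinuousMap.sub_apply, ContinuousMap.smul_apply, convC_embL2, smul_eq_mul, hc,
    ← integral_sub]
  · calc ‖∫ y, f y * star (r (y * x⁻¹) : ℂ) - f x * (r (y * x⁻¹) : ℂ) ∂μ‖
        ≤ ∫ y, ε * r (y * x⁻¹) ∂μ := by
          refine norm_integral_le_of_norm_le ((hrint x).const_mul ε) (.of_forall fun y => ?_)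
          rw [RCLike.star_def, Complex.conj_ofReal, ← sub_mul, norm_mul, Complex.norm_real,
            Real.norm_of_nonneg (hr0 _)]
          by_cases hy : y * x⁻¹ ∈ U
          · refine mul_le_mul_of_nonneg_right ?_ (hr0 _)
            have := (F (y * x⁻¹) - f).norm_coe_le_norm x
            have h2 : (F (y * x⁻¹) - f) x = f y - f x := by simp [F]
            rw [h2] at this
            exact this.trans (le_of_lt hy)
          · rw [hrU _ hy, mul_zero, mul_zero]
      _ = ε * ∫ g, r g ∂μ := by
          rw [integral_const_mul, integral_mul_right_eq_self (fun y => r y) x⁻¹]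
  · exact Continuous.integrable_of_hasCompactSupport (by fun_prop)
      (HasCompactSupport.of_compactSpace _)
  · exact Continuous.integrable_of_hasCompactSupport (by fun_prop)
      (HasCompactSupport.of_compactSpace _)

theorem norm_embL2_le (f : C(G, ℂ)) : ‖embL2 μ f‖ ≤ ‖f‖ := by
  have h := (embL2 μ).le_opNorm f
  have h2 : ‖(embL2 μ : C(G, ℂ) →L[ℂ] Lp ℂ 2 μ)‖ ≤ 1 := by
    refine (ContinuousMap.toLp_norm_le (p := 2) (μ := μ) (𝕜 := ℂ)).trans ?_
    simp [measureUnivNNReal]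
  exact h.trans (by simpa using mul_le_mul_of_nonneg_right h2 (norm_nonneg f))

/-- **Peter–Weyl theorem**: the representative functions are dense in `L²(G)`. -/
theorem eq_zero_of_orthogonal_representative {u : Lp ℂ 2 μ}
    (hu : ∀ h ∈ representative G, inner ℂ (embL2 μ h) u = 0) : u = 0 := by
  have hC : ∀ f : C(G, ℂ), inner ℂ (embL2 μ f) u = 0 := by
    intro f
    rw [← norm_eq_zero]
    refine le_antisymm (le_of_forall_pos_le_add fun ε hε => ?_) (norm_nonneg _)
    rw [zero_add]
    -- Convolution moves onto `u`, where it vanishes, so `c ⟨f, u⟩` is only the approximation error.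
    -- The `+ 1` keeps the tolerance meaningful when `u = 0`.
    obtain ⟨k, hk, c, hc, hle⟩ := exists_kernel_norm_sub_le μ f
      (ε := ε / (‖u‖ + 1)) (by positivity)
    have hz : inner ℂ (embL2 μ (convC μ k (embL2 μ f))) u = 0 := by
      have : inner ℂ (convL2 μ k (embL2 μ f)) u = inner ℂ (embL2 μ f) (convL2 μ k u) :=
        isSymmetric_convL2 μ hk _ _
      rw [← convL2_apply, this, convL2_eq_zero_of_orthogonal μ hk hu, inner_zero_right]
    have h1 : c * ‖inner ℂ (embL2 μ f) u‖ ≤ ε / (‖u‖ + 1) * c * ‖u‖ := by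
      calc c * ‖inner ℂ (embL2 μ f) u‖
          = ‖inner ℂ (embL2 μ (convC μ k (embL2 μ f) - (c : ℂ) • f)) u‖ := by
            rw [map_sub, inner_sub_left, hz, map_smul, inner_smul_left]
            simp [abs_of_pos hc]
        _ ≤ ‖embL2 μ (convC μ k (embL2 μ f) - (c : ℂ) • f)‖ * ‖u‖ := norm_inner_le_norm _ _
        _ ≤ _ := by gcongr; exact (norm_embL2_le μ _).trans hle
    have h2 : ‖inner ℂ (embL2 μ f) u‖ ≤ ε / (‖u‖ + 1) * ‖u‖ := by
      refine le_of_mul_le_mul_left ?_ hc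
      linarith
    refine h2.trans ?_
    rw [div_mul_eq_mul_div, div_le_iff₀ (by positivity)]
    nlinarith [norm_nonneg u]
  have : inner ℂ u u = (0 : ℂ) :=
    (denseRange_embL2 μ).induction_on (p := fun v => inner ℂ v u = (0 : ℂ)) u
      (isClosed_eq (by fun_prop) (by fun_prop)) hC
  exact inner_self_eq_zero.mp this

end Convolution

/-! ### Squared norms with values in `[0, ∞]`, and the chosen representations. -/

/-- The squared Hilbert–Schmidt norm of a matrix. -/
noncomputable def hsSq {m n : Type*} [Fintype m] [Fintype n] (A : Matrix m n ℂ) : ℝ≥0∞ :=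
  ∑ j, ∑ k, ‖A j k‖ₑ ^ 2

theorem eLpNorm_two_sq {X : Type*} [MeasurableSpace X] (ν : Measure X) (f : X → ℂ) :
    eLpNorm f 2 ν ^ 2 = ∫⁻ x, ‖f x‖ₑ ^ 2 ∂ν := by
  have := eLpNorm_nnreal_pow_eq_lintegral (f := f) (μ := ν) (p := 2) two_ne_zero
  simpa using this

theorem enorm_Lp_sq {X : Type*} [MeasurableSpace X] (ν : Measure X) (f : Lp ℂ 2 ν) :
    ‖f‖ₑ ^ 2 = ∫⁻ x, ‖f x‖ₑ ^ 2 ∂ν := by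
  rw [Lp.enorm_def, eLpNorm_two_sq]

theorem memLp_two_of_lintegral {X : Type*} [MeasurableSpace X] {ν : Measure X} {f : X → ℂ}
    (hf : AEStronglyMeasurable f ν) (h : ∫⁻ x, ‖f x‖ₑ ^ 2 ∂ν ≠ ∞) : MemLp f 2 ν := by
  refine ⟨hf, ?_⟩
  rw [← eLpNorm_two_sq] at h
  exact lt_top_iff_ne_top.mpr fun h' => h (by rw [h']; rfl)

theorem enorm_sq_eq_ofReal {E : Type*} [SeminormedAddCommGroup E] (x : E) :
    ‖x‖ₑ ^ 2 = ENNReal.ofReal (‖x‖ ^ 2) := by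
  rw [ENNReal.ofReal_pow (norm_nonneg _), ofReal_norm]

namespace DualSystem

variable {G : Type*} [Group G] [TopologicalSpace G] (S : DualSystem G)

theorem d_pos (η : UnitaryDual G) : 0 < S.d η := (S.rep η).dim_pos

theorem continuous_mat (η : UnitaryDual G) : Continuous (S.mat η) := (S.rep η).continuous_mat

theorem conjTranspose_mat_mul_mat (η : UnitaryDual G) (x : G) : (S.mat η x)ᴴ * S.mat η x = 1 :=
  (S.rep η).conjTranspose_mat_mul_mat x

theorem mat_mul_conjTranspose_mat (η : UnitaryDual G) (x : G) : S.mat η x * (S.mat η x)ᴴ = 1 :=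
  (S.rep η).mat_mul_conjTranspose_mat x

theorem not_equivalent {η ξ : UnitaryDual G} (h : η ≠ ξ) : ¬ (S.rep η).Equivalent (S.rep ξ) :=
  fun he => h (by rw [← S.rep_mem η, ← S.rep_mem ξ]; exact Quotient.sound he)

end DualSystem

/-! ### The Peter–Weyl basis and Plancherel's formula. -/

section Plancherel

variable {G : Type*} [Group G] [TopologicalSpace G] [IsTopologicalGroup G] [CompactSpace G]
  [T2Space G] [MeasurableSpace G] [BorelSpace G]
  (μ : Measure G) [μ.IsHaarMeasure] [IsProbabilityMeasure μ] [μ.Regular] (S : DualSystem G)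

/-- The coefficient function `x ↦ η(x)_{jk}`. -/
noncomputable def DualSystem.coeff (η : UnitaryDual G) (j k : Fin (S.d η)) : C(G, ℂ) :=
  (S.rep η).coeff j k

@[simp]
theorem DualSystem.coeff_apply (η : UnitaryDual G) (j k : Fin (S.d η)) (x : G) :
    S.coeff η j k x = S.mat η x j k := rfl

/-- Every irreducible representation is unitarily conjugate to the chosen one in its class, so its
coefficients are combinations of the chosen coefficients. -/
theorem representative_le_span :
    representative G ≤ Submodule.span ℂ {f | ∃ η j k, f = S.coeff η j k} := by
  refine Submodule.span_le.mpr ?_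
  rintro _ ⟨ξ, i, j, rfl⟩
  obtain ⟨η, U, -, hU, hξ⟩ : ∃ η : UnitaryDual G, ξ.Equivalent (S.rep η) :=
    ⟨Quotient.mk (unitaryIrrepSetoid G) ξ, Quotient.exact (S.rep_mem _).symm⟩
  have h1 : ∀ x, ξ.mat x = Uᴴ * ((S.rep η).mat x * U) := fun x => by
    rw [← hξ x, ← Matrix.mul_assoc, hU, Matrix.one_mul]
  have h2 : ξ.coeff i j = ∑ p, ∑ q, (Uᴴ i p * U q j) • S.coeff η p q := by
    ext x
    change ξ.mat x i j = _
    rw [h1, Matrix.mul_apply]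
    simp only [Matrix.mul_apply, Finset.mul_sum, ContinuousMap.coe_sum, ContinuousMap.coe_smul,
      Finset.sum_apply, Pi.smul_apply, smul_eq_mul]
    refine Finset.sum_congr rfl fun p _ => Finset.sum_congr rfl fun q _ => ?_
    change _ * (S.mat η x p q * _) = _ * S.mat η x p q
    ring
  rw [h2]
  exact Submodule.sum_mem _ fun p _ => Submodule.sum_mem _ fun q _ =>
    Submodule.smul_mem _ _ (Submodule.subset_span ⟨η, p, q, rfl⟩)

theorem inner_coeff_self (η : UnitaryDual G) (i p j q : Fin (S.d η)) :
    inner ℂ (embL2 μ (S.coeff η j q)) (embL2 μ (S.coeff η i p))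
      = if i = j ∧ p = q then (S.d η : ℂ)⁻¹ else 0 := by
  rw [inner_embL2_embL2]
  exact (S.rep η).integral_mat_mul_star_self μ i p j q

theorem inner_coeff_of_ne {η ξ : UnitaryDual G} (h : ξ ≠ η) (i p : Fin (S.d η))
    (j q : Fin (S.d ξ)) :
    inner ℂ (embL2 μ (S.coeff ξ j q)) (embL2 μ (S.coeff η i p)) = 0 := by
  rw [inner_embL2_embL2]
  exact UnitaryIrrep.integral_mat_mul_star_of_not_equivalent μ (S.not_equivalent h) i p j q

/-- The normalized coefficient functions `√d_η η_{jk}`. -/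
noncomputable def basisVec (i : Σ η : UnitaryDual G, Fin (S.d η) × Fin (S.d η)) : Lp ℂ 2 μ :=
  ((Real.sqrt (S.d i.1) : ℝ) : ℂ) • embL2 μ (S.coeff i.1 i.2.1 i.2.2)

theorem sqrt_mul_sqrt_dim (η : UnitaryDual G) :
    ((Real.sqrt (S.d η) : ℝ) : ℂ) * ((Real.sqrt (S.d η) : ℝ) : ℂ) = S.d η := by
  rw [← Complex.ofReal_mul, Real.mul_self_sqrt (Nat.cast_nonneg _), Complex.ofReal_natCast]

theorem orthonormal_basisVec : Orthonormal ℂ (basisVec μ S) := by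
  classical
  rw [orthonormal_iff_ite]
  rintro ⟨ξ, j, q⟩ ⟨η, i, p⟩
  simp only [basisVec, inner_smul_left, inner_smul_right, Complex.conj_ofReal]
  by_cases h : ξ = η
  · subst h
    have hd : (S.d ξ : ℂ) ≠ 0 := by exact_mod_cast (S.d_pos ξ).ne'
    rw [inner_coeff_self, ← mul_assoc, sqrt_mul_sqrt_dim]
    by_cases h1 : j = i <;> by_cases h2 : q = p <;> simp [h1, h2, hd, eq_comm]
  · rw [inner_coeff_of_ne μ S h, if_neg (fun h' => h (congrArg Sigma.fst h')), mul_zero, mul_zero]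

/-- The Hilbert basis of `L²(G)` given by the Peter–Weyl theorem. -/
noncomputable def peterWeylBasis :
    HilbertBasis (Σ η : UnitaryDual G, Fin (S.d η) × Fin (S.d η)) ℂ (Lp ℂ 2 μ) :=
  HilbertBasis.mkOfOrthogonalEqBot (orthonormal_basisVec μ S) <| by
    rw [eq_bot_iff]
    intro u hu
    rw [Submodule.mem_orthogonal] at hu
    refine eq_zero_of_orthogonal_representative μ fun h hh => ?_
    have hle : Submodule.span ℂ {f | ∃ η j k, f = S.coeff η j k}
        ≤ (Submodule.span ℂ (Set.range (basisVec μ S))).comap (embL2 μ).toLinearMap := by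
      refine Submodule.span_le.mpr ?_
      rintro _ ⟨η, j, k, rfl⟩
      have hd : ((Real.sqrt (S.d η) : ℝ) : ℂ) ≠ 0 := by
        have := Real.sqrt_pos.mpr (Nat.cast_pos (α := ℝ) |>.mpr (S.d_pos η))
        exact_mod_cast this.ne'
      have : embL2 μ (S.coeff η j k)
          = ((Real.sqrt (S.d η) : ℝ) : ℂ)⁻¹ • basisVec μ S ⟨η, j, k⟩ := by
        rw [basisVec, inv_smul_smul₀ hd]
      change embL2 μ (S.coeff η j k) ∈ Submodule.span ℂ (Set.range (basisVec μ S))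
      rw [this]
      exact Submodule.smul_mem _ _ (Submodule.subset_span ⟨_, rfl⟩)
    exact hu _ (hle (representative_le_span S hh))

@[simp]
theorem coe_peterWeylBasis : ⇑(peterWeylBasis μ S) = basisVec μ S :=
  HilbertBasis.coe_mkOfOrthogonalEqBot _ _

theorem tsum_enorm_inner_sq {ι H : Type*} [NormedAddCommGroup H] [InnerProductSpace ℂ H]
    (b : HilbertBasis ι ℂ H) (u : H) : ∑' i, ‖(inner ℂ (b i) u : ℂ)‖ₑ ^ 2 = ‖u‖ₑ ^ 2 := by
  have h := b.hasSum_inner_mul_inner u u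
  have h1 : ∀ i, (inner ℂ u (b i) : ℂ) * inner ℂ (b i) u = ((‖(inner ℂ (b i) u : ℂ)‖ ^ 2 : ℝ) : ℂ) :=
    fun i => by
      rw [← inner_conj_symm, Complex.conj_mul']; push_cast; rfl
  have h2 : (inner ℂ u u : ℂ) = ((‖u‖ ^ 2 : ℝ) : ℂ) := by
    rw [inner_self_eq_norm_sq_to_K]; push_cast; rfl
  simp only [h1, h2] at h
  have h3 := Complex.hasSum_ofReal.mp h
  simp only [enorm_sq_eq_ofReal]
  rw [← ENNReal.ofReal_tsum_of_nonneg (fun i => by positivity) h3.summable, h3.tsum_eq]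

theorem fourierCoeff_congr_ae {f g : G → ℂ} (h : f =ᵐ[μ] g) (η : UnitaryDual G) :
    fourierCoeff μ S f η = fourierCoeff μ S g η := by
  ext j k
  refine integral_congr_ae ?_
  filter_upwards [h] with x hx
  rw [hx]

/-- The indices are exchanged because `v̂(η)` integrates against the adjoint `η(x)^*`. -/
theorem fourierCoeff_apply_eq_inner (u : Lp ℂ 2 μ) (η : UnitaryDual G) (j k : Fin (S.d η)) :
    fourierCoeff μ S u η j k = inner ℂ (embL2 μ (S.coeff η k j)) u := by
  rw [inner_embL2]; rfl

theorem enorm_inner_basisVec_sq (u : Lp ℂ 2 μ) (η : UnitaryDual G) (j k : Fin (S.d η)) :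
    ‖(inner ℂ (basisVec μ S ⟨η, k, j⟩) u : ℂ)‖ₑ ^ 2
      = (S.d η : ℝ≥0∞) * ‖fourierCoeff μ S u η j k‖ₑ ^ 2 := by
  rw [basisVec, inner_smul_left, Complex.conj_ofReal, enorm_mul, mul_pow,
    fourierCoeff_apply_eq_inner]
  congr 1
  rw [enorm_sq_eq_ofReal, Complex.norm_real, Real.norm_of_nonneg (Real.sqrt_nonneg _),
    Real.sq_sqrt (Nat.cast_nonneg _), ENNReal.ofReal_natCast]

/-- **Plancherel's formula** on a compact group. -/
theorem plancherel (u : Lp ℂ 2 μ) :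
    ∑' η, (S.d η : ℝ≥0∞) * hsSq (fourierCoeff μ S u η) = ‖u‖ₑ ^ 2 := by
  rw [← tsum_enorm_inner_sq (peterWeylBasis μ S) u, ENNReal.tsum_sigma']
  refine tsum_congr fun η => ?_
  rw [tsum_fintype, Fintype.sum_prod_type, Finset.sum_comm, hsSq, Finset.mul_sum]
  refine Finset.sum_congr rfl fun j _ => ?_
  rw [Finset.mul_sum]
  refine Finset.sum_congr rfl fun k _ => ?_
  rw [coe_peterWeylBasis, enorm_inner_basisVec_sq]

theorem plancherel_of_memLp {f : G → ℂ} (hf : MemLp f 2 μ) :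
    ∑' η, (S.d η : ℝ≥0∞) * hsSq (fourierCoeff μ S f η) = ∫⁻ x, ‖f x‖ₑ ^ 2 ∂μ := by
  have h := plancherel μ S (hf.toLp f)
  rw [Lp.enorm_toLp, eLpNorm_two_sq] at h
  rw [← h]
  exact tsum_congr fun η => by rw [fourierCoeff_congr_ae μ S hf.coeFn_toLp]

/-- The function `y ↦ d_η tr (η(y) A)`. -/
noncomputable def traceFun (η : UnitaryDual G) (A : Matrix (Fin (S.d η)) (Fin (S.d η)) ℂ) :
    C(G, ℂ) :=
  ⟨fun y => (S.d η : ℂ) * (S.mat η y * A).trace,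
    continuous_const.mul ((S.continuous_mat η).matrix_mul continuous_const).matrix_trace⟩

theorem traceFun_apply (η : UnitaryDual G) (A) (y : G) :
    traceFun S η A y = (S.d η : ℂ) * (S.mat η y * A).trace := rfl

theorem traceFun_eq_sum (η : UnitaryDual G) (A : Matrix (Fin (S.d η)) (Fin (S.d η)) ℂ) :
    traceFun S η A = ∑ j, ∑ k, ((S.d η : ℂ) * A k j) • S.coeff η j k := by
  ext y
  simp only [traceFun_apply, Matrix.trace, Matrix.diag_apply, Matrix.mul_apply, Finset.mul_sum,
    ContinuousMap.coe_sum, ContinuousMap.coe_smul, Finset.sum_apply, Pi.smul_apply, smul_eq_mul,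
    DualSystem.coeff_apply]
  exact Finset.sum_congr rfl fun j _ => Finset.sum_congr rfl fun k _ => by ring

/-- The `L²` norm of `y ↦ d_η tr (η(y) A)`. -/
theorem lintegral_enorm_traceFun_sq (η : UnitaryDual G)
    (A : Matrix (Fin (S.d η)) (Fin (S.d η)) ℂ) :
    ∫⁻ y, ‖traceFun S η A y‖ₑ ^ 2 ∂μ = (S.d η : ℝ≥0∞) * hsSq A := by
  have hd : (S.d η : ℂ) ≠ 0 := by exact_mod_cast (S.d_pos η).ne'
  have h1 : ∫⁻ y, ‖traceFun S η A y‖ₑ ^ 2 ∂μ = ‖embL2 μ (traceFun S η A)‖ₑ ^ 2 := by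
    rw [enorm_Lp_sq]
    refine lintegral_congr_ae ?_
    filter_upwards [ContinuousMap.coeFn_toLp (p := 2) (𝕜 := ℂ) μ (traceFun S η A)] with x hx
    rw [hx]
  -- Schur orthogonality collapses the fourfold sum; the factor `d_η²` from the coefficients meets
  -- `d_η⁻¹`, leaving one `d_η`.
  have h2 : (inner ℂ (embL2 μ (traceFun S η A)) (embL2 μ (traceFun S η A)) : ℂ)
      = ((S.d η * ∑ j, ∑ k, ‖A j k‖ ^ 2 : ℝ) : ℂ) := by
    rw [traceFun_eq_sum]
    simp only [map_sum, map_smul, sum_inner, inner_sum, inner_smul_left, inner_smul_right,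
      inner_coeff_self]
    simp only [ite_and, mul_ite, mul_zero, Finset.sum_ite_eq, Finset.mem_univ,
      if_true, Finset.sum_ite_irrel, Finset.sum_const_zero]
    rw [Finset.sum_comm]
    push_cast
    rw [Finset.mul_sum]
    refine Finset.sum_congr rfl fun j _ => ?_
    rw [Finset.mul_sum]
    refine Finset.sum_congr rfl fun k _ => ?_
    rw [← Complex.mul_conj']
    simp only [map_mul, Complex.conj_natCast]
    field_simp
  have h3 : ‖embL2 μ (traceFun S η A)‖ ^ 2 = S.d η * ∑ j, ∑ k, ‖A j k‖ ^ 2 := by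
    apply Complex.ofReal_injective
    rw [← h2, inner_self_eq_norm_sq_to_K]
    push_cast
    rfl
  rw [h1, enorm_sq_eq_ofReal, h3, ENNReal.ofReal_mul (Nat.cast_nonneg _), ENNReal.ofReal_natCast,
    ENNReal.ofReal_sum_of_nonneg fun _ _ => by positivity, hsSq]
  congr 1
  refine Finset.sum_congr rfl fun j _ => ?_
  rw [ENNReal.ofReal_sum_of_nonneg fun _ _ => by positivity]
  exact Finset.sum_congr rfl fun k _ => (enorm_sq_eq_ofReal _).symm

/-- `∫ f(y) (d_η tr (η(y) A))^* dy = d_η tr (f̂(η) A^*)`. -/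
theorem integral_mul_star_traceFun {f : G → ℂ} (hf : Integrable f μ) (η : UnitaryDual G)
    (A : Matrix (Fin (S.d η)) (Fin (S.d η)) ℂ) :
    ∫ y, f y * star (traceFun S η A y) ∂μ
      = (S.d η : ℂ) * (fourierCoeff μ S f η * Aᴴ).trace := by
  have hint : ∀ j k, Integrable (fun y => f y * star (S.mat η y j k)) μ := fun j k => by
    have hc : Continuous fun y => star (S.mat η y j k) := ((S.continuous_mat η).matrix_elem j k).star
    obtain ⟨C, hC⟩ := (isCompact_range hc).isBounded.exists_norm_le
    exact hf.mul_bdd hc.aestronglyMeasurable (.of_forall fun y => hC _ ⟨y, rfl⟩)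
  have h1 : ∀ y, f y * star (traceFun S η A y)
      = ∑ j, ∑ k, ((S.d η : ℂ) * star (A k j)) * (f y * star (S.mat η y j k)) := fun y => by
    rw [traceFun_eq_sum]
    simp only [ContinuousMap.coe_sum, ContinuousMap.coe_smul, Finset.sum_apply, Pi.smul_apply,
      smul_eq_mul, DualSystem.coeff_apply, star_sum, Finset.mul_sum, star_mul', star_natCast]
    exact Finset.sum_congr rfl fun j _ => Finset.sum_congr rfl fun k _ => by ring
  simp only [h1]
  rw [integral_finsetSum _ fun j _ => integrable_finsetSum _ fun k _ => (hint j k).const_mul _]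
  simp only [Matrix.trace, Matrix.diag_apply, Matrix.mul_apply, Finset.mul_sum,
    Matrix.conjTranspose_apply]
  rw [Finset.sum_comm]
  refine Finset.sum_congr rfl fun j _ => ?_
  rw [integral_finsetSum _ fun k _ => (hint j k).const_mul _]
  refine Finset.sum_congr rfl fun k _ => ?_
  rw [integral_const_mul]
  simp only [fourierCoeff, Matrix.of_apply, Matrix.conjTranspose_apply]
  ring

theorem integral_traceFun_mul_star_traceFun {η ξ : UnitaryDual G} (h : ξ ≠ η) (A B) :
    ∫ y, traceFun S η A y * star (traceFun S ξ B y) ∂μ = 0 := by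
  rw [← inner_embL2_embL2, traceFun_eq_sum, traceFun_eq_sum]
  simp only [map_sum, map_smul, sum_inner, inner_sum, inner_smul_left, inner_smul_right,
    inner_coeff_of_ne μ S h, mul_zero, Finset.sum_const_zero]

end Plancherel

/-! ### Series of pairwise orthogonal vectors. -/

section Orthogonal

variable {ι H : Type*} [NormedAddCommGroup H] [InnerProductSpace ℂ H] [CompleteSpace H]

theorem enorm_sum_sq_of_orthogonal {f : ι → H}
    (hf : Pairwise fun i j => (inner ℂ (f i) (f j) : ℂ) = 0) (s : Finset ι) :
    ‖∑ i ∈ s, f i‖ₑ ^ 2 = ∑ i ∈ s, ‖f i‖ₑ ^ 2 := by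
  have h : ‖∑ i ∈ s, f i‖ ^ 2 = ∑ i ∈ s, ‖f i‖ ^ 2 := by
    apply Complex.ofReal_injective
    have h1 : (inner ℂ (∑ i ∈ s, f i) (∑ i ∈ s, f i) : ℂ) = ∑ i ∈ s, inner ℂ (f i) (f i) := by
      rw [sum_inner]
      refine Finset.sum_congr rfl fun i hi => ?_
      rw [inner_sum, Finset.sum_eq_single i (fun j _ hj => hf hj.symm) (fun h => absurd hi h)]
    rw [inner_self_eq_norm_sq_to_K] at h1
    simp only [inner_self_eq_norm_sq_to_K] at h1
    push_cast
    exact h1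
  simp only [enorm_sq_eq_ofReal]
  rw [h, ENNReal.ofReal_sum_of_nonneg fun _ _ => by positivity]

theorem summable_of_orthogonal {f : ι → H}
    (hf : Pairwise fun i j => (inner ℂ (f i) (f j) : ℂ) = 0) (h : ∑' i, ‖f i‖ₑ ^ 2 ≠ ∞) :
    Summable f := by
  let V : ι → Submodule ℂ H := fun i => ℂ ∙ f i
  have hV : OrthogonalFamily ℂ (fun i => V i) fun i => (V i).subtypeₗᵢ := by
    rintro i j hij ⟨v, hv⟩ ⟨w, hw⟩
    obtain ⟨a, rfl⟩ := Submodule.mem_span_singleton.mp hv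
    obtain ⟨b, rfl⟩ := Submodule.mem_span_singleton.mp hw
    change inner ℂ (a • f i) (b • f j) = (0 : ℂ)
    rw [inner_smul_left, inner_smul_right, hf hij, mul_zero, mul_zero]
  have h2 := hV.summable_iff_norm_sq_summable fun i => ⟨f i, Submodule.mem_span_singleton_self _⟩
  refine h2.mpr ?_
  change Summable fun i => ‖f i‖ ^ 2
  simp only [enorm_sq_eq_ofReal] at h
  have := ENNReal.summable_toReal h
  simpa [ENNReal.toReal_ofReal] using this

/-- Pythagoras for finite partial sums, then passage to the limit. -/
theorem enorm_tsum_sq_le_of_orthogonal {f : ι → H}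
    (hf : Pairwise fun i j => (inner ℂ (f i) (f j) : ℂ) = 0) (h : ∑' i, ‖f i‖ₑ ^ 2 ≠ ∞) :
    ‖∑' i, f i‖ₑ ^ 2 ≤ ∑' i, ‖f i‖ₑ ^ 2 := by
  have hs := (summable_of_orthogonal hf h).hasSum
  have ht : Filter.Tendsto (fun s : Finset ι => ‖∑ i ∈ s, f i‖ₑ ^ 2) Filter.atTop
      (nhds (‖∑' i, f i‖ₑ ^ 2)) := ((ENNReal.continuous_pow 2).tendsto _).comp hs.enorm
  refine le_of_tendsto ht (.of_forall fun s => ?_)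
  rw [enorm_sum_sq_of_orthogonal hf]
  exact ENNReal.sum_le_tsum s

end Orthogonal

/-! ### The `L²` spaces of matrix-valued functions. -/

section Plane

variable {G : Type*} [Group G] [TopologicalSpace G] [MeasurableSpace G]
  (μ : Measure G) (S : DualSystem G)

/-- The squared norm of `L²(G × Ĝ)`. -/
noncomputable def planeSq (a : PlaneFun S) : ℝ≥0∞ :=
  ∑' η, (S.d η : ℝ≥0∞) * ∫⁻ x, hsSq (a η x) ∂μ

theorem l2Norm_sq (a : PlaneFun S) : l2Norm μ S a ^ 2 = planeSq μ S a := by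
  have : l2Norm μ S a = planeSq μ S a ^ (1 / 2 : ℝ) := rfl
  rw [this, ← ENNReal.rpow_natCast, ← ENNReal.rpow_mul]
  norm_num

theorem memL2_iff (a : PlaneFun S) :
    MemL2 μ S a ↔ PlaneMeasurable μ S a ∧ planeSq μ S a ≠ ∞ := by
  rw [MemL2, ← l2Norm_sq, lt_top_iff_ne_top]
  simp

variable {μ S} in
theorem MemL2.planeSq_ne_top {a : PlaneFun S} (ha : MemL2 μ S a) : planeSq μ S a ≠ ∞ :=
  ((memL2_iff μ S a).mp ha).2

variable {μ S} in
theorem MemL2.term_ne_top {a : PlaneFun S} (ha : MemL2 μ S a) (η : UnitaryDual G) :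
    (S.d η : ℝ≥0∞) * ∫⁻ x, hsSq (a η x) ∂μ ≠ ∞ :=
  ne_top_of_le_ne_top ha.planeSq_ne_top (ENNReal.le_tsum η)

variable {μ S} in
theorem PlaneMeasurable.aemeasurable_hsSq {a : PlaneFun S} (ha : PlaneMeasurable μ S a)
    (η : UnitaryDual G) : AEMeasurable (fun x => hsSq (a η x)) μ := by
  unfold hsSq
  exact Finset.aemeasurable_fun_sum _ fun j _ => Finset.aemeasurable_fun_sum _ fun k _ =>
    (ha η j k).enorm.pow_const 2

theorem toL2_of_memLp {f : G × G → ℂ} (hf : MemLp f 2 (μ.prod μ)) : toL2 μ f = hf.toLp f :=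
  dif_pos hf

end Plane

/-! ### Partial Fourier transforms on `G × G`. -/

section Product

variable {G : Type*} [Group G] [TopologicalSpace G] [IsTopologicalGroup G] [CompactSpace G]
  [T2Space G] [MeasurableSpace G] [BorelSpace G]
  (μ : Measure G) [μ.IsHaarMeasure] [IsProbabilityMeasure μ] [μ.Regular] (S : DualSystem G)

/-- The function `(x, y) ↦ d_η tr (η(y) a(x,η))`. -/
noncomputable def sndFun (a : PlaneFun S) (η : UnitaryDual G) (p : G × G) : ℂ :=
  traceFun S η (a η p.1) p.2

theorem seriesSnd_eq (a : PlaneFun S) (η : UnitaryDual G) :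
    seriesSnd μ S a η = toL2 μ (sndFun S a η) := rfl

variable {μ S}

theorem PlaneMeasurable.sndFun {a : PlaneFun S} (ha : PlaneMeasurable μ S a) (η : UnitaryDual G) :
    AEStronglyMeasurable (sndFun S a η) (μ.prod μ) := by
  have : TimeFreq.sndFun S a η
      = fun p => ∑ j, ∑ k, ((S.d η : ℂ) * a η p.1 k j) * S.coeff η j k p.2 := by
    ext p
    rw [TimeFreq.sndFun, traceFun_eq_sum]
    simp
  rw [this]
  refine Finset.aestronglyMeasurable_fun_sum _ fun j _ =>
    Finset.aestronglyMeasurable_fun_sum _ fun k _ => ?_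
  have h1 : AEStronglyMeasurable (fun p : G × G => a η p.1 k j) (μ.prod μ) := (ha η k j).comp_fst
  have h2 : AEStronglyMeasurable (fun p : G × G => S.coeff η j k p.2) (μ.prod μ) :=
    (S.coeff η j k).continuous.aestronglyMeasurable.comp_snd
  exact (h1.const_mul _).mul h2

theorem lintegral_enorm_sndFun_sq {a : PlaneFun S} (ha : PlaneMeasurable μ S a)
    (η : UnitaryDual G) : ∫⁻ p, ‖sndFun S a η p‖ₑ ^ 2 ∂μ.prod μ
      = (S.d η : ℝ≥0∞) * ∫⁻ x, hsSq (a η x) ∂μ := by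
  rw [lintegral_prod _ ((ha.sndFun η).enorm.pow_const 2),
    ← lintegral_const_mul'' _ (ha.aemeasurable_hsSq η)]
  exact lintegral_congr fun x => lintegral_enorm_traceFun_sq μ S η (a η x)

theorem MemL2.memLp_sndFun {a : PlaneFun S} (ha : MemL2 μ S a) (η : UnitaryDual G) :
    MemLp (sndFun S a η) 2 (μ.prod μ) := by
  refine memLp_two_of_lintegral (ha.1.sndFun η) ?_
  rw [lintegral_enorm_sndFun_sq ha.1]
  exact ha.term_ne_top η

theorem MemL2.seriesSnd_eq_toLp {a : PlaneFun S} (ha : MemL2 μ S a) (η : UnitaryDual G) :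
    seriesSnd μ S a η = (ha.memLp_sndFun η).toLp _ :=
  toL2_of_memLp μ _

theorem MemL2.enorm_seriesSnd_sq {a : PlaneFun S} (ha : MemL2 μ S a) (η : UnitaryDual G) :
    ‖seriesSnd μ S a η‖ₑ ^ 2 = (S.d η : ℝ≥0∞) * ∫⁻ x, hsSq (a η x) ∂μ := by
  rw [ha.seriesSnd_eq_toLp, Lp.enorm_toLp, eLpNorm_two_sq, lintegral_enorm_sndFun_sq ha.1]

theorem MemL2.inner_seriesSnd {a : PlaneFun S} (ha : MemL2 μ S a) (η : UnitaryDual G)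
    {g : G × G → ℂ} (hg : MemLp g 2 (μ.prod μ)) :
    inner ℂ (seriesSnd μ S a η) (hg.toLp g)
      = ∫ x, ∫ y, g (x, y) * star (traceFun S η (a η x) y) ∂μ ∂μ := by
  rw [ha.seriesSnd_eq_toLp, L2.inner_def]
  have h1 : ∫ p, inner ℂ ((ha.memLp_sndFun η).toLp _ p) (hg.toLp g p) ∂μ.prod μ
      = ∫ p, g p * star (sndFun S a η p) ∂μ.prod μ := by
    refine integral_congr_ae ?_
    filter_upwards [(ha.memLp_sndFun η).coeFn_toLp, hg.coeFn_toLp] with p h1 h2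
    rw [h1, h2]; rfl
  exact h1.trans (integral_prod _ (MemLp.integrable_mul hg (ha.memLp_sndFun η).star))

/-- Orthogonality already holds on each slice, in the variable `y` alone. -/
theorem MemL2.pairwise_seriesSnd {a : PlaneFun S} (ha : MemL2 μ S a) :
    Pairwise fun η ξ => (inner ℂ (seriesSnd μ S a η) (seriesSnd μ S a ξ) : ℂ) = 0 := by
  intro η ξ h
  rw [ha.seriesSnd_eq_toLp ξ, ha.inner_seriesSnd]
  simp only [sndFun, integral_traceFun_mul_star_traceFun μ S h, integral_zero]

theorem MemL2.tsum_enorm_seriesSnd_sq {a : PlaneFun S} (ha : MemL2 μ S a) :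
    ∑' η, ‖seriesSnd μ S a η‖ₑ ^ 2 = planeSq μ S a :=
  tsum_congr fun η => ha.enorm_seriesSnd_sq η

theorem MemL2.summable_seriesSnd {a : PlaneFun S} (ha : MemL2 μ S a) :
    Summable (seriesSnd μ S a) :=
  summable_of_orthogonal ha.pairwise_seriesSnd <| by
    rw [ha.tsum_enorm_seriesSnd_sq]; exact ha.planeSq_ne_top

theorem MemL2.enorm_invFourierSnd_le {a : PlaneFun S} (ha : MemL2 μ S a) :
    ‖invFourierSnd μ S a‖ₑ ≤ l2Norm μ S a := by
  have h := enorm_tsum_sq_le_of_orthogonal ha.pairwise_seriesSnd <| by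
    rw [ha.tsum_enorm_seriesSnd_sq]; exact ha.planeSq_ne_top
  rw [ha.tsum_enorm_seriesSnd_sq, ← l2Norm_sq] at h
  exact (ENNReal.pow_le_pow_left_iff two_ne_zero).mp h

theorem ae_memLp_section {g : G × G → ℂ} (hg : MemLp g 2 (μ.prod μ)) :
    ∀ᵐ x ∂μ, MemLp (fun y => g (x, y)) 2 μ := by
  have h1 : ∫⁻ x, ∫⁻ y, ‖g (x, y)‖ₑ ^ 2 ∂μ ∂μ ≠ ∞ := by
    rw [← lintegral_prod (fun p => ‖g p‖ₑ ^ 2) (hg.1.enorm.pow_const 2), ← eLpNorm_two_sq]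
    exact ENNReal.pow_ne_top hg.2.ne
  filter_upwards [hg.1.prodMk_left, ae_lt_top' (hg.1.enorm.pow_const 2).lintegral_prod_right' h1]
    with x hx1 hx2
  exact memLp_two_of_lintegral hx1 hx2.ne

variable (S) in
theorem planeMeasurable_fourierSnd {g : G × G → ℂ} (hg : MemLp g 2 (μ.prod μ)) :
    PlaneMeasurable μ S (fourierSnd μ S g) := by
  intro η j k
  have h : AEStronglyMeasurable (fun p : G × G => g p * (S.mat η p.2)ᴴ j k) (μ.prod μ) :=
    hg.1.mul (((S.continuous_mat η).matrix_conjTranspose.matrix_elem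
      j k).aestronglyMeasurable.comp_snd)
  exact h.integral_prod_right'

variable (S) in
-- Plancherel on almost every slice. The sum over a possibly uncountable dual is not exchanged with
-- the integral: finite partial sums suffice, and they give the one inequality that is needed.
theorem planeSq_fourierSnd_le {g : G × G → ℂ} (hg : MemLp g 2 (μ.prod μ)) :
    planeSq μ S (fourierSnd μ S g) ≤ eLpNorm g 2 (μ.prod μ) ^ 2 := by
  have hm := planeMeasurable_fourierSnd S hg
  rw [planeSq, ENNReal.tsum_eq_iSup_sum]
  refine iSup_le fun s => ?_
  calc ∑ η ∈ s, (S.d η : ℝ≥0∞) * ∫⁻ x, hsSq (fourierSnd μ S g η x) ∂μ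
      = ∫⁻ x, ∑ η ∈ s, (S.d η : ℝ≥0∞) * hsSq (fourierSnd μ S g η x) ∂μ := by
        rw [lintegral_finsetSum' _ fun η _ => (hm.aemeasurable_hsSq η).const_mul _]
        exact Finset.sum_congr rfl fun η _ =>
          (lintegral_const_mul'' _ (hm.aemeasurable_hsSq η)).symm
    _ ≤ ∫⁻ x, ∫⁻ y, ‖g (x, y)‖ₑ ^ 2 ∂μ ∂μ := by
        refine lintegral_mono_ae ?_
        filter_upwards [ae_memLp_section hg] with x hx
        rw [← plancherel_of_memLp μ S hx]
        exact ENNReal.sum_le_tsum s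
    _ = eLpNorm g 2 (μ.prod μ) ^ 2 := by
        rw [eLpNorm_two_sq, lintegral_prod (fun p => ‖g p‖ₑ ^ 2) (hg.1.enorm.pow_const 2)]

variable (S) in
theorem memL2_fourierSnd {g : G × G → ℂ} (hg : MemLp g 2 (μ.prod μ)) :
    MemL2 μ S (fourierSnd μ S g) :=
  (memL2_iff μ S _).mpr ⟨planeMeasurable_fourierSnd S hg,
    ne_top_of_le_ne_top (ENNReal.pow_ne_top hg.2.ne) (planeSq_fourierSnd_le S hg)⟩

variable (S) in
theorem l2Norm_fourierSnd_le {g : G × G → ℂ} (hg : MemLp g 2 (μ.prod μ)) :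
    l2Norm μ S (fourierSnd μ S g) ≤ eLpNorm g 2 (μ.prod μ) := by
  have h := planeSq_fourierSnd_le S hg
  rw [← l2Norm_sq] at h
  exact (ENNReal.pow_le_pow_left_iff two_ne_zero).mp h

/-- The partial Fourier transform and the partial inverse transform are adjoint. -/
theorem MemL2.planeInner_fourierSnd {a : PlaneFun S} (ha : MemL2 μ S a) {g : G × G → ℂ}
    (hg : MemLp g 2 (μ.prod μ)) :
    planeInner μ S (fourierSnd μ S g) a = inner ℂ (invFourierSnd μ S a) (hg.toLp g) := by
  have hterm : ∀ η, (S.d η : ℂ) * ∫ x, (fourierSnd μ S g η x * (a η x)ᴴ).trace ∂μ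
      = inner ℂ (seriesSnd μ S a η) (hg.toLp g) := fun η => by
    rw [ha.inner_seriesSnd, ← integral_const_mul]
    refine integral_congr_ae ?_
    filter_upwards [ae_memLp_section hg] with x hx
    rw [integral_mul_star_traceFun μ S (hx.integrable one_le_two)]
    rfl
  -- The adjoint relation has been checked one frequency at a time; continuity of the inner product
  -- sums it.
  have hs : HasSum (fun η => (inner ℂ (seriesSnd μ S a η) (hg.toLp g) : ℂ))
      (inner ℂ (invFourierSnd μ S a) (hg.toLp g)) :=
    ha.summable_seriesSnd.hasSum.mapL (innerSL ℂ |>.flip (hg.toLp g))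
  rw [planeInner, tsum_congr hterm, hs.tsum_eq]

/-- The exceptional null set may depend on `η`, since each term of the series sees only a class in
`L²(G × G)`. -/
theorem MemL2.invFourierSnd_linear {a b c : PlaneFun S} (ha : MemL2 μ S a) (hb : MemL2 μ S b)
    (r : ℂ) (h : ∀ η, ∀ᵐ x ∂μ, c η x = r • a η x + b η x) :
    invFourierSnd μ S c = r • invFourierSnd μ S a + invFourierSnd μ S b := by
  have hterm : ∀ η, seriesSnd μ S c η = r • seriesSnd μ S a η + seriesSnd μ S b η := fun η => by
    have hae : r • sndFun S a η + sndFun S b η =ᵐ[μ.prod μ] sndFun S c η := by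
      have := Measure.quasiMeasurePreserving_fst (μ := μ) (ν := μ) |>.ae (h η)
      filter_upwards [this] with p hp
      simp only [Pi.add_apply, Pi.smul_apply, sndFun, traceFun_apply, hp, smul_eq_mul,
        Matrix.mul_add, Matrix.mul_smul, Matrix.trace_add, Matrix.trace_smul]
      ring
    have hm := ((ha.memLp_sndFun η).const_smul r).add (hb.memLp_sndFun η)
    have hc : MemLp (sndFun S c η) 2 (μ.prod μ) := hm.ae_eq hae
    rw [seriesSnd_eq, toL2_of_memLp μ hc, ha.seriesSnd_eq_toLp, hb.seriesSnd_eq_toLp,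
      ← MemLp.toLp_const_smul, ← MemLp.toLp_add]
    exact (MemLp.toLp_eq_toLp_iff _ _).mpr hae.symm
  rw [invFourierSnd, tsum_congr hterm,
    (ha.summable_seriesSnd.const_smul r).tsum_add hb.summable_seriesSnd,
    ha.summable_seriesSnd.tsum_const_smul]
  rfl

variable (S) in
theorem fourierSnd_linear {f g h : G × G → ℂ} (hf : MemLp f 2 (μ.prod μ))
    (hg : MemLp g 2 (μ.prod μ)) (r : ℂ) (hh : h =ᵐ[μ.prod μ] r • f + g) (η : UnitaryDual G) :
    ∀ᵐ x ∂μ, fourierSnd μ S h η x = r • fourierSnd μ S f η x + fourierSnd μ S g η x := by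
  filter_upwards [ae_memLp_section hf, ae_memLp_section hg, Measure.ae_ae_of_ae_prod hh]
    with x h1 h2 h3
  ext j k
  have hint : ∀ {u : G → ℂ}, MemLp u 2 μ → Integrable (fun y => u y * (S.mat η y)ᴴ j k) μ := by
    intro u hu
    have hc : Continuous fun y => (S.mat η y)ᴴ j k :=
      (S.continuous_mat η).matrix_conjTranspose.matrix_elem j k
    obtain ⟨C, hC⟩ := (isCompact_range hc).isBounded.exists_norm_le
    exact (hu.integrable one_le_two).mul_bdd hc.aestronglyMeasurable
      (.of_forall fun y => hC _ ⟨y, rfl⟩)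
  simp only [fourierSnd, fourierCoeff, Matrix.of_apply, Matrix.add_apply, Matrix.smul_apply,
    smul_eq_mul]
  rw [← integral_const_mul, ← integral_add ((hint h1).const_mul r) (hint h2)]
  refine integral_congr_ae ?_
  filter_upwards [h3] with y hy
  simp only [Pi.add_apply, Pi.smul_apply, smul_eq_mul] at hy
  rw [hy]
  ring

variable (μ) in
/-- The exchange of the two variables, on `L²(G × G)`. -/
noncomputable def swapL2 : Lp ℂ 2 (μ.prod μ) →ₗᵢ[ℂ] Lp ℂ 2 (μ.prod μ) :=
  Lp.compMeasurePreservingₗᵢ ℂ Prod.swap Measure.measurePreserving_swap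

theorem memLp_comp_swap {f : G × G → ℂ} (hf : MemLp f 2 (μ.prod μ)) :
    MemLp (f ∘ Prod.swap) 2 (μ.prod μ) :=
  hf.comp_measurePreserving Measure.measurePreserving_swap

/-- Exchanging the variables preserves the measure, so the results for the second variable carry
over isometrically to the first. -/
theorem MemL2.seriesFst_eq {b : PlaneFun S} (hb : MemL2 μ S b) (ξ : UnitaryDual G) :
    seriesFst μ S b ξ = swapL2 μ (seriesSnd μ S b ξ) := by
  have h : seriesFst μ S b ξ = toL2 μ (sndFun S b ξ ∘ Prod.swap) := rfl
  rw [h, toL2_of_memLp μ (memLp_comp_swap (hb.memLp_sndFun ξ)), hb.seriesSnd_eq_toLp]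
  exact (Lp.toLp_compMeasurePreserving (hb.memLp_sndFun ξ) Measure.measurePreserving_swap).symm

theorem MemL2.summable_seriesFst {b : PlaneFun S} (hb : MemL2 μ S b) :
    Summable (seriesFst μ S b) := by
  rw [show seriesFst μ S b = fun ξ => swapL2 μ (seriesSnd μ S b ξ) from funext hb.seriesFst_eq]
  exact hb.summable_seriesSnd.mapL (swapL2 μ).toContinuousLinearMap

theorem MemL2.invFourierFst_eq {b : PlaneFun S} (hb : MemL2 μ S b) :
    invFourierFst μ S b = swapL2 μ (invFourierSnd μ S b) := by
  rw [invFourierFst, tsum_congr hb.seriesFst_eq]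
  exact (hb.summable_seriesSnd.hasSum.mapL (swapL2 μ).toContinuousLinearMap).tsum_eq

theorem MemL2.enorm_invFourierFst_le {b : PlaneFun S} (hb : MemL2 μ S b) :
    ‖invFourierFst μ S b‖ₑ ≤ l2Norm μ S b := by
  rw [hb.invFourierFst_eq, LinearIsometry.enorm_map]
  exact hb.enorm_invFourierSnd_le

variable (μ S) in
theorem fourierFst_eq (g : G × G → ℂ) : fourierFst μ S g = fourierSnd μ S (g ∘ Prod.swap) := rfl

end Product

/-! ### Cauchy–Schwarz and Hilbert–Schmidt inequalities. -/

section HilbertSchmidt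

/-- The Cauchy–Schwarz inequality for series in `[0, ∞]`. -/
theorem tsum_sq_le {ι : Type*} {c A B : ι → ℝ≥0∞} (h : ∀ i, c i ^ 2 ≤ A i * B i) :
    (∑' i, c i) ^ 2 ≤ (∑' i, A i) * ∑' i, B i := by
  have hroot : ∀ t : ℝ≥0∞, (t ^ (1 / 2 : ℝ)) ^ 2 = t := fun t => by
    rw [← ENNReal.rpow_natCast, ← ENNReal.rpow_mul]; norm_num
  have hc : ∀ i, c i ≤ A i ^ (1 / 2 : ℝ) * B i ^ (1 / 2 : ℝ) := fun i => by
    rw [← ENNReal.pow_le_pow_left_iff two_ne_zero, mul_pow, hroot, hroot]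
    exact h i
  have hle : ∑' i, c i ≤ (∑' i, A i) ^ (1 / 2 : ℝ) * (∑' i, B i) ^ (1 / 2 : ℝ) := by
    rw [ENNReal.tsum_eq_iSup_sum (f := c)]
    refine iSup_le fun s => ?_
    calc ∑ i ∈ s, c i ≤ ∑ i ∈ s, A i ^ (1 / 2 : ℝ) * B i ^ (1 / 2 : ℝ) :=
          Finset.sum_le_sum fun i _ => hc i
      _ ≤ (∑ i ∈ s, A i) ^ (1 / 2 : ℝ) * (∑ i ∈ s, B i) ^ (1 / 2 : ℝ) := by
          have := ENNReal.inner_le_Lp_mul_Lq s (fun i => A i ^ (1 / 2 : ℝ))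
            (fun i => B i ^ (1 / 2 : ℝ)) Real.HolderConjugate.two_two
          simpa only [← ENNReal.rpow_mul, one_div, inv_mul_cancel₀ (two_ne_zero (α := ℝ)),
            ENNReal.rpow_one] using this
      _ ≤ _ := by gcongr <;> exact ENNReal.sum_le_tsum s
  calc (∑' i, c i) ^ 2 ≤ ((∑' i, A i) ^ (1 / 2 : ℝ) * (∑' i, B i) ^ (1 / 2 : ℝ)) ^ 2 := by gcongr
    _ = _ := by rw [mul_pow, hroot, hroot]

variable {n : Type*} [Fintype n]

theorem hsSq_conjTranspose (A : Matrix n n ℂ) : hsSq Aᴴ = hsSq A := by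
  rw [hsSq, Finset.sum_comm, hsSq]
  simp [Matrix.conjTranspose_apply]

theorem hsSq_smul (c : ℂ) (A : Matrix n n ℂ) : hsSq (c • A) = ‖c‖ₑ ^ 2 * hsSq A := by
  simp only [hsSq, Finset.mul_sum, Matrix.smul_apply, smul_eq_mul, enorm_mul, mul_pow]

theorem hsSq_eq_enorm_trace (A : Matrix n n ℂ) : hsSq A = ‖(Aᴴ * A).trace‖ₑ := by
  have h : (Aᴴ * A).trace = ((∑ j, ∑ k, ‖A j k‖ ^ 2 : ℝ) : ℂ) := by
    simp only [Matrix.trace, Matrix.diag_apply, Matrix.mul_apply, Matrix.conjTranspose_apply]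
    rw [Finset.sum_comm]
    push_cast
    exact Finset.sum_congr rfl fun j _ => Finset.sum_congr rfl fun k _ => Complex.conj_mul' _
  rw [h, ← ofReal_norm, Complex.norm_real, Real.norm_of_nonneg (by positivity),
    ENNReal.ofReal_sum_of_nonneg fun _ _ => by positivity, hsSq]
  refine Finset.sum_congr rfl fun j _ => ?_
  rw [ENNReal.ofReal_sum_of_nonneg fun _ _ => by positivity]
  exact Finset.sum_congr rfl fun k _ => enorm_sq_eq_ofReal _

theorem hsSq_isometry_mul [DecidableEq n] {U : Matrix n n ℂ} (hU : Uᴴ * U = 1)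
    (A : Matrix n n ℂ) : hsSq (U * A) = hsSq A := by
  rw [hsSq_eq_enorm_trace, hsSq_eq_enorm_trace, Matrix.conjTranspose_mul, Matrix.mul_assoc,
    ← Matrix.mul_assoc Uᴴ, hU, Matrix.one_mul]

theorem enorm_trace_mul_sq_le (A B : Matrix n n ℂ) :
    ‖(A * B).trace‖ₑ ^ 2 ≤ hsSq A * hsSq B := by
  have h := tsum_sq_le (ι := n × n) (c := fun i => ‖A i.1 i.2 * B i.2 i.1‖ₑ)
    (A := fun i => ‖A i.1 i.2‖ₑ ^ 2) (B := fun i => ‖B i.2 i.1‖ₑ ^ 2)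
    fun i => by rw [enorm_mul, mul_pow]
  rw [tsum_fintype, tsum_fintype, tsum_fintype, Fintype.sum_prod_type, Fintype.sum_prod_type,
    Fintype.sum_prod_type, Finset.sum_comm (f := fun j k => ‖B k j‖ₑ ^ 2)] at h
  refine le_trans ?_ h
  gcongr
  refine (enorm_sum_le _ _).trans (Finset.sum_le_sum fun j _ => ?_)
  rw [Matrix.diag_apply, Matrix.mul_apply]
  exact enorm_sum_le _ _

/-- The squared norm is a sum over columns, each of which `M` stretches by at most its operator
norm. -/
theorem hsSq_mul_le [DecidableEq n] (M A : Matrix n n ℂ) :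
    hsSq (M * A) ≤ ‖Matrix.toEuclideanCLM (n := n) (𝕜 := ℂ) M‖ₑ ^ 2 * hsSq A := by
  have hnorm : ∀ w : n → ℂ, ‖(WithLp.toLp 2 w : EuclideanSpace ℂ n)‖ₑ ^ 2 = ∑ j, ‖w j‖ₑ ^ 2 :=
    fun w => by
      rw [enorm_sq_eq_ofReal, EuclideanSpace.norm_sq_eq,
        ENNReal.ofReal_sum_of_nonneg fun _ _ => by positivity]
      exact Finset.sum_congr rfl fun j _ => (enorm_sq_eq_ofReal _).symm
  simp only [hsSq]
  rw [Finset.sum_comm, Finset.sum_comm (f := fun j k => ‖A j k‖ₑ ^ 2), Finset.mul_sum]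
  refine Finset.sum_le_sum fun k _ => ?_
  have h := (Matrix.toEuclideanCLM (n := n) (𝕜 := ℂ) M).le_opENorm (WithLp.toLp 2 fun j => A j k)
  rw [Matrix.toEuclideanCLM_toLp] at h
  have h2 := pow_le_pow_left₀ zero_le h 2
  rw [mul_pow, hnorm, hnorm] at h2
  exact h2

end HilbertSchmidt

/-! ### The transform `D(u,v)` and the quantization `a^D`. -/

section Kernel

variable {G : Type*} [Group G] [TopologicalSpace G] [IsTopologicalGroup G] [CompactSpace G]
  [T2Space G] [MeasurableSpace G] [BorelSpace G]
  {μ : Measure G} [μ.IsHaarMeasure] [IsProbabilityMeasure μ] [μ.Regular] {S : DualSystem G}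

theorem planeMeasurable_knTransform (u v : Lp ℂ 2 μ) :
    PlaneMeasurable μ S (knTransform μ S u v) := by
  intro η j k
  have h : Continuous fun x => ((S.mat η x)ᴴ * (fourierCoeff μ S v η)ᴴ) j k :=
    ((S.continuous_mat η).matrix_conjTranspose.matrix_mul continuous_const).matrix_elem j k
  exact (Lp.aestronglyMeasurable u).mul h.aestronglyMeasurable

/-- Adjoints and unitary factors preserve the Hilbert–Schmidt norm, so the variables separate and
Plancherel for `v` computes the norm of `R(u,v)`. -/
theorem hsSq_knTransform (u v : Lp ℂ 2 μ) (η : UnitaryDual G) (x : G) :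
    hsSq (knTransform μ S u v η x) = ‖u x‖ₑ ^ 2 * hsSq (fourierCoeff μ S v η) := by
  rw [knTransform, hsSq_smul, hsSq_isometry_mul, hsSq_conjTranspose]
  rw [Matrix.conjTranspose_conjTranspose, S.mat_mul_conjTranspose_mat]

theorem planeSq_knTransform (u v : Lp ℂ 2 μ) :
    planeSq μ S (knTransform μ S u v) = (‖u‖ₑ * ‖v‖ₑ) ^ 2 := by
  rw [mul_pow, ← plancherel μ S v, ← ENNReal.tsum_mul_left, planeSq]
  refine tsum_congr fun η => ?_
  simp only [hsSq_knTransform]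
  rw [lintegral_mul_const'' _ ((Lp.aestronglyMeasurable u).enorm.pow_const 2), ← enorm_Lp_sq]
  ring

theorem memL2_knTransform (u v : Lp ℂ 2 μ) : MemL2 μ S (knTransform μ S u v) :=
  (memL2_iff μ S _).mpr ⟨planeMeasurable_knTransform u v, by
    rw [planeSq_knTransform]
    exact ENNReal.pow_ne_top (ENNReal.mul_ne_top enorm_ne_top enorm_ne_top)⟩

theorem l2Norm_knTransform (u v : Lp ℂ 2 μ) :
    l2Norm μ S (knTransform μ S u v) = ‖u‖ₑ * ‖v‖ₑ := by
  have h : l2Norm μ S (knTransform μ S u v) ^ 2 = (‖u‖ₑ * ‖v‖ₑ) ^ 2 := by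
    rw [l2Norm_sq, planeSq_knTransform]
  exact le_antisymm ((ENNReal.pow_le_pow_left_iff two_ne_zero).mp h.le)
    ((ENNReal.pow_le_pow_left_iff two_ne_zero).mp h.ge)

theorem PlaneMeasurable.mul {φ b : PlaneFun S} (hφ : PlaneMeasurable μ S φ)
    (hb : PlaneMeasurable μ S b) : PlaneMeasurable μ S fun ξ y => φ ξ y * b ξ y := by
  intro ξ j k
  simp only [Matrix.mul_apply]
  exact Finset.aestronglyMeasurable_fun_sum _ fun l _ => (hφ ξ j l).mul (hb ξ l k)

theorem planeSq_kernel_mul_le {φ b : PlaneFun S} (hb : PlaneMeasurable μ S b) :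
    planeSq μ S (fun ξ y => φ ξ y * b ξ y) ≤ linftyNorm μ S φ ^ 2 * planeSq μ S b := by
  rw [planeSq, planeSq, ← ENNReal.tsum_mul_left]
  refine ENNReal.tsum_le_tsum fun ξ => ?_
  rw [mul_left_comm, ← lintegral_const_mul'' _ (hb.aemeasurable_hsSq ξ)]
  refine mul_le_mul' le_rfl (lintegral_mono_ae ?_)
  filter_upwards [ENNReal.ae_le_essSup (μ := μ) fun y =>
    ‖Matrix.toEuclideanCLM (n := Fin (S.d ξ)) (𝕜 := ℂ) (φ ξ y)‖ₑ] with y hy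
  refine (hsSq_mul_le _ _).trans ?_
  gcongr
  exact hy.trans (le_iSup (fun ξ => essSup (fun y =>
    ‖Matrix.toEuclideanCLM (n := Fin (S.d ξ)) (𝕜 := ℂ) (φ ξ y)‖ₑ) μ) ξ)

theorem MemL2.kernel_mul {φ b : PlaneFun S} (hb : MemL2 μ S b) (hφ : PlaneMeasurable μ S φ)
    (hfin : linftyNorm μ S φ < ∞) : MemL2 μ S fun ξ y => φ ξ y * b ξ y :=
  (memL2_iff μ S _).mpr ⟨hφ.mul hb.1, ne_top_of_le_ne_top
    (ENNReal.mul_ne_top (ENNReal.pow_ne_top hfin.ne) hb.planeSq_ne_top)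
    (planeSq_kernel_mul_le hb.1)⟩

theorem MemL2.l2Norm_kernel_mul_le {φ b : PlaneFun S} (hb : MemL2 μ S b) :
    l2Norm μ S (fun ξ y => φ ξ y * b ξ y) ≤ linftyNorm μ S φ * l2Norm μ S b := by
  rw [← ENNReal.pow_le_pow_left_iff two_ne_zero, mul_pow, l2Norm_sq, l2Norm_sq]
  exact planeSq_kernel_mul_le hb.1

variable (S) in
theorem memL2_fourierFst (g : Lp ℂ 2 (μ.prod μ)) : MemL2 μ S (fourierFst μ S g) :=
  memL2_fourierSnd S (memLp_comp_swap (Lp.memLp g))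

variable (S) in
theorem l2Norm_fourierFst_le (g : Lp ℂ 2 (μ.prod μ)) : l2Norm μ S (fourierFst μ S g) ≤ ‖g‖ₑ := by
  refine (l2Norm_fourierSnd_le S (memLp_comp_swap (Lp.memLp g))).trans_eq ?_
  rw [eLpNorm_comp_measurePreserving (Lp.aestronglyMeasurable g) Measure.measurePreserving_swap,
    Lp.enorm_def]

variable (μ S) in
/-- The operator `(𝓕⁻¹ ⊗ I) φ (𝓕 ⊗ I)` on `L²(G × G)`. -/
noncomputable def kernelOp (φ : PlaneFun S) (g : Lp ℂ 2 (μ.prod μ)) : Lp ℂ 2 (μ.prod μ) :=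
  invFourierFst μ S fun ξ y => φ ξ y * fourierFst μ S g ξ y

variable {φ : PlaneFun S}

theorem memL2_kernel_fourierFst (hφ : PlaneMeasurable μ S φ) (hfin : linftyNorm μ S φ < ∞)
    (g : Lp ℂ 2 (μ.prod μ)) : MemL2 μ S fun ξ y => φ ξ y * fourierFst μ S g ξ y :=
  (memL2_fourierFst S g).kernel_mul hφ hfin

theorem enorm_kernelOp_le (hφ : PlaneMeasurable μ S φ) (hfin : linftyNorm μ S φ < ∞)
    (g : Lp ℂ 2 (μ.prod μ)) : ‖kernelOp μ S φ g‖ₑ ≤ linftyNorm μ S φ * ‖g‖ₑ :=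
  calc ‖kernelOp μ S φ g‖ₑ ≤ l2Norm μ S (fun ξ y => φ ξ y * fourierFst μ S g ξ y) :=
        (memL2_kernel_fourierFst hφ hfin g).enorm_invFourierFst_le
    _ ≤ linftyNorm μ S φ * l2Norm μ S (fourierFst μ S g) :=
        (memL2_fourierFst S g).l2Norm_kernel_mul_le
    _ ≤ linftyNorm μ S φ * ‖g‖ₑ := by gcongr; exact l2Norm_fourierFst_le S g

theorem kernelOp_linear (hφ : PlaneMeasurable μ S φ) (hfin : linftyNorm μ S φ < ∞) (r : ℂ)
    (f g : Lp ℂ 2 (μ.prod μ)) :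
    kernelOp μ S φ (r • f + g) = r • kernelOp μ S φ f + kernelOp μ S φ g := by
  simp only [kernelOp]
  rw [(memL2_kernel_fourierFst hφ hfin _).invFourierFst_eq,
    (memL2_kernel_fourierFst hφ hfin _).invFourierFst_eq,
    (memL2_kernel_fourierFst hφ hfin _).invFourierFst_eq, ← map_smul, ← map_add]
  congr 1
  refine (memL2_kernel_fourierFst hφ hfin f).invFourierSnd_linear
    (memL2_kernel_fourierFst hφ hfin g) r fun ξ => ?_
  have hae : ⇑(r • f + g) =ᵐ[μ.prod μ] r • ⇑f + ⇑g := by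
    filter_upwards [Lp.coeFn_add (r • f) g, Lp.coeFn_smul r f] with p h1 h2
    rw [h1, Pi.add_apply, h2, Pi.add_apply]
  have hswap : ⇑(r • f + g) ∘ Prod.swap =ᵐ[μ.prod μ] r • (⇑f ∘ Prod.swap) + ⇑g ∘ Prod.swap :=
    Measure.measurePreserving_swap.quasiMeasurePreserving.ae_eq hae
  filter_upwards [fourierSnd_linear S (memLp_comp_swap (Lp.memLp f))
    (memLp_comp_swap (Lp.memLp g)) r hswap ξ] with y hy
  rw [fourierFst_eq, hy, Matrix.mul_add, Matrix.mul_smul]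
  rfl

variable (μ S) in
/-- The function `(I ⊗ 𝓕⁻¹) R(u,v)` on `G × G`. -/
noncomputable def knKernel (u v : Lp ℂ 2 μ) : Lp ℂ 2 (μ.prod μ) :=
  invFourierSnd μ S (knTransform μ S u v)

theorem enorm_knKernel_le (u v : Lp ℂ 2 μ) : ‖knKernel μ S u v‖ₑ ≤ ‖u‖ₑ * ‖v‖ₑ :=
  (memL2_knTransform u v).enorm_invFourierSnd_le.trans_eq (l2Norm_knTransform u v)

theorem knKernel_linear_left (r : ℂ) (u u' v : Lp ℂ 2 μ) :
    knKernel μ S (r • u + u') v = r • knKernel μ S u v + knKernel μ S u' v := by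
  refine (memL2_knTransform u v).invFourierSnd_linear (memL2_knTransform u' v) r fun η => ?_
  filter_upwards [Lp.coeFn_add (r • u) u', Lp.coeFn_smul r u] with x h1 h2
  simp only [knTransform]
  rw [h1, Pi.add_apply, h2, Pi.smul_apply, add_smul, smul_eq_mul, mul_smul]

theorem knKernel_linear_right (r : ℂ) (u v v' : Lp ℂ 2 μ) :
    knKernel μ S u (r • v + v') = star r • knKernel μ S u v + knKernel μ S u v' := by
  refine (memL2_knTransform u v).invFourierSnd_linear (memL2_knTransform u v') (star r) fun η => ?_
  refine .of_forall fun x => ?_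
  have h : fourierCoeff μ S (r • v + v' : Lp ℂ 2 μ) η
      = r • fourierCoeff μ S v η + fourierCoeff μ S v' η := by
    ext j k
    simp only [Matrix.add_apply, Matrix.smul_apply, fourierCoeff_apply_eq_inner, inner_add_right,
      inner_smul_right, smul_eq_mul]
  simp only [knTransform]
  rw [h, Matrix.conjTranspose_add, Matrix.conjTranspose_smul, Matrix.mul_add, smul_add,
    Matrix.mul_smul, smul_comm]

/-- This factorization through `L²(G × G)` reduces every bound to one for each factor. -/
theorem tfTransform_eq (φ : PlaneFun S) (u v : Lp ℂ 2 μ) :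
    tfTransform μ S φ u v = fourierSnd μ S (kernelOp μ S φ (knKernel μ S u v)) := rfl

theorem memL2_tfTransform (u v : Lp ℂ 2 μ) : MemL2 μ S (tfTransform μ S φ u v) :=
  memL2_fourierSnd S (Lp.memLp _)

theorem enorm_kernelOp_knKernel_le (hφ : PlaneMeasurable μ S φ) (hfin : linftyNorm μ S φ < ∞)
    (u v : Lp ℂ 2 μ) :
    ‖kernelOp μ S φ (knKernel μ S u v)‖ₑ ≤ linftyNorm μ S φ * ‖u‖ₑ * ‖v‖ₑ := by
  refine (enorm_kernelOp_le hφ hfin _).trans ?_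
  rw [mul_assoc]
  gcongr
  exact enorm_knKernel_le u v

theorem l2Norm_tfTransform_le (hφ : PlaneMeasurable μ S φ) (hfin : linftyNorm μ S φ < ∞)
    (u v : Lp ℂ 2 μ) :
    l2Norm μ S (tfTransform μ S φ u v) ≤ linftyNorm μ S φ * ‖u‖ₑ * ‖v‖ₑ := by
  refine (l2Norm_fourierSnd_le S (Lp.memLp _)).trans ?_
  rw [← Lp.enorm_def]
  exact enorm_kernelOp_knKernel_le hφ hfin u v

theorem MemL2.planeInner_tfTransform {a : PlaneFun S} (ha : MemL2 μ S a) (φ : PlaneFun S)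
    (u v : Lp ℂ 2 μ) : planeInner μ S (tfTransform μ S φ u v) a
      = inner ℂ (invFourierSnd μ S a) (kernelOp μ S φ (knKernel μ S u v)) := by
  rw [tfTransform_eq, ha.planeInner_fourierSnd (Lp.memLp _), Lp.toLp_coeFn]

theorem MemL2.enorm_planeInner_tfTransform_le {a : PlaneFun S} (ha : MemL2 μ S a)
    (hφ : PlaneMeasurable μ S φ) (hfin : linftyNorm μ S φ < ∞) (u v : Lp ℂ 2 μ) :
    ‖planeInner μ S (tfTransform μ S φ u v) a‖ₑ
      ≤ linftyNorm μ S φ * l2Norm μ S a * ‖v‖ₑ * ‖u‖ₑ := by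
  have hcs : ∀ f g : Lp ℂ 2 (μ.prod μ), ‖(inner ℂ f g : ℂ)‖ₑ ≤ ‖f‖ₑ * ‖g‖ₑ := fun f g => by
    rw [← ofReal_norm, ← ofReal_norm, ← ofReal_norm, ← ENNReal.ofReal_mul (norm_nonneg _)]
    exact ENNReal.ofReal_le_ofReal (norm_inner_le_norm f g)
  rw [ha.planeInner_tfTransform]
  calc _ ≤ _ := hcs _ _
    _ ≤ l2Norm μ S a * (linftyNorm μ S φ * ‖u‖ₑ * ‖v‖ₑ) := by
        gcongr
        · exact ha.enorm_invFourierSnd_le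
        · exact enorm_kernelOp_knKernel_le hφ hfin u v
    _ = _ := by ring

/-- The sesquilinear form `(v, u) ↦ ⟨D(u,v), a⟩`. -/
noncomputable def tfForm (hφ : PlaneMeasurable μ S φ) (hfin : linftyNorm μ S φ < ∞)
    {a : PlaneFun S} (ha : MemL2 μ S a) : Lp ℂ 2 μ →L⋆[ℂ] Lp ℂ 2 μ →L[ℂ] ℂ :=
  LinearMap.mkContinuous₂
    (LinearMap.mk₂'ₛₗ (starRingEnd ℂ) (RingHom.id ℂ)
      (fun v u : Lp ℂ 2 μ => planeInner μ S (tfTransform μ S φ u v) a)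
      (fun v v' u => by
        have h := knKernel_linear_right (S := S) 1 u v v'
        have h2 := kernelOp_linear hφ hfin 1 (knKernel μ S u v) (knKernel μ S u v')
        simp only [star_one, one_smul] at h h2
        simp only [ha.planeInner_tfTransform, h, h2, inner_add_right])
      (fun r v u => by
        -- Additivity at zero gives `T 0 = T 0 + T 0`, so `T 0 = 0`; this isolates homogeneity from
        -- the combined linearity statement.
        have h0 := kernelOp_linear hφ hfin 1 0 0
        have hk0 := knKernel_linear_right (S := S) 1 u 0 0
        simp only [star_one, one_smul, add_zero, left_eq_add] at h0 hk0
        have h := knKernel_linear_right (S := S) r u v 0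
        have h2 := kernelOp_linear hφ hfin (star r) (knKernel μ S u v) 0
        simp only [hk0, h0, add_zero] at h h2
        simp only [ha.planeInner_tfTransform, h, h2, inner_smul_right]
        rfl)
      (fun v u u' => by
        have h := knKernel_linear_left (S := S) 1 u u' v
        have h2 := kernelOp_linear hφ hfin 1 (knKernel μ S u v) (knKernel μ S u' v)
        simp only [one_smul] at h h2
        simp only [ha.planeInner_tfTransform, h, h2, inner_add_right])
      (fun r v u => by
        have h0 := kernelOp_linear hφ hfin 1 0 0
        have hk0 := knKernel_linear_left (S := S) 1 0 0 v
        simp only [one_smul, add_zero, left_eq_add] at h0 hk0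
        have h := knKernel_linear_left (S := S) r u 0 v
        have h2 := kernelOp_linear hφ hfin r (knKernel μ S u v) 0
        simp only [hk0, h0, add_zero] at h h2
        simp only [ha.planeInner_tfTransform, h, h2, inner_smul_right]
        rfl))
    (linftyNorm μ S φ * l2Norm μ S a).toReal fun v u => by
      have h := ENNReal.toReal_mono (ENNReal.mul_ne_top (ENNReal.mul_ne_top
        (ENNReal.mul_ne_top hfin.ne ha.2.ne) enorm_ne_top) enorm_ne_top)
        (ha.enorm_planeInner_tfTransform_le hφ hfin u v)
      rw [ENNReal.toReal_mul, ENNReal.toReal_mul] at h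
      simp only [toReal_enorm] at h
      exact h

/-- Riesz representation applied to `tfForm`. Uniqueness holds among all maps, since the inner
products with every `u` determine a vector. -/
theorem exists_quantization (hφ : PlaneMeasurable μ S φ) (hfin : linftyNorm μ S φ < ∞)
    {a : PlaneFun S} (ha : MemL2 μ S a) :
    ∃ A : Lp ℂ 2 μ →L[ℂ] Lp ℂ 2 μ, IsQuantization μ S φ a A ∧
      (∀ B : Lp ℂ 2 μ → Lp ℂ 2 μ, IsQuantization μ S φ a B → B = A) ∧
      ∀ v : Lp ℂ 2 μ, ‖A v‖ₑ ≤ linftyNorm μ S φ * l2Norm μ S a * ‖v‖ₑ := by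
  let A := InnerProductSpace.continuousLinearMapOfBilin (tfForm hφ hfin ha)
  have hA : IsQuantization μ S φ a A := fun u v =>
    InnerProductSpace.continuousLinearMapOfBilin_apply (tfForm hφ hfin ha) v u
  refine ⟨A, hA, fun B hB => funext fun v => ext_inner_right ℂ fun u => ?_, fun v => ?_⟩
  · rw [hB u v, hA u v]
  -- Testing the form at `u = A v` gives `‖A v‖²` on the left; one factor is then cancelled.
  · have h := ha.enorm_planeInner_tfTransform_le hφ hfin (A v) v
    rw [← hA (A v) v] at h
    by_cases h0 : ‖A v‖ₑ = 0
    · rw [h0]; exact zero_le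
    · have hsq : ‖(inner ℂ (A v) (A v) : ℂ)‖ₑ = ‖A v‖ₑ * ‖A v‖ₑ := by
        rw [inner_self_eq_norm_sq_to_K, ← ofReal_norm, ← ofReal_norm,
          ← ENNReal.ofReal_mul (norm_nonneg _), norm_pow, RCLike.norm_ofReal, abs_norm, sq]
      rw [hsq] at h
      exact (ENNReal.mul_le_mul_iff_left h0 enorm_ne_top).mp h

end Kernel

/-! ### The Kohn–Nirenberg operator. -/

section KohnNirenberg

variable {G : Type*} [Group G] [TopologicalSpace G] [IsTopologicalGroup G] [CompactSpace G]
  [T2Space G] [MeasurableSpace G] [BorelSpace G]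
  {μ : Measure G} [μ.IsHaarMeasure] [IsProbabilityMeasure μ] [μ.Regular] {S : DualSystem G}
  {a : PlaneFun S}

/-- Cauchy–Schwarz for the trace, with `d_η²` split evenly so that each factor is a term of a sum
already controlled: that of `a` and that of Plancherel for `v`. -/
theorem enorm_knTerm_sq_le (a : PlaneFun S) (v : Lp ℂ 2 μ) (x : G) (η : UnitaryDual G) :
    ‖knTerm μ S a v x η‖ₑ ^ 2 ≤ ((S.d η : ℝ≥0∞) * hsSq (a η x))
      * ((S.d η : ℝ≥0∞) * hsSq (fourierCoeff μ S v η)) := by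
  have hd : ‖(S.d η : ℂ)‖ₑ = (S.d η : ℝ≥0∞) := by
    rw [← ofReal_norm, Complex.norm_natCast, ENNReal.ofReal_natCast]
  rw [knTerm, enorm_mul, mul_pow, hd]
  calc (S.d η : ℝ≥0∞) ^ 2 * ‖(S.mat η x * a η x * fourierCoeff μ S v η).trace‖ₑ ^ 2
      ≤ (S.d η : ℝ≥0∞) ^ 2 * (hsSq (S.mat η x * a η x) * hsSq (fourierCoeff μ S v η)) := by
        gcongr; exact enorm_trace_mul_sq_le _ _
    _ = _ := by rw [hsSq_isometry_mul (S.conjTranspose_mat_mul_mat η x)]; ring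

variable (μ S) in
/-- The frequencies at which the Fourier coefficient of `v` does not vanish. -/
def spectrumSet (v : Lp ℂ 2 μ) : Set (UnitaryDual G) :=
  Function.support fun η => (S.d η : ℝ≥0∞) * hsSq (fourierCoeff μ S v η)

/-- A finite sum in `[0, ∞]` has countable support. Restricting to this support permits
measurability of sums and their exchange with integrals. -/
theorem countable_spectrumSet (v : Lp ℂ 2 μ) : (spectrumSet μ S v).Countable :=
  Summable.countable_support_ennreal <| by
    rw [plancherel]; exact ENNReal.pow_ne_top enorm_ne_top

theorem knTerm_eq_zero (a : PlaneFun S) (v : Lp ℂ 2 μ) (x : G) {η : UnitaryDual G}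
    (h : η ∉ spectrumSet μ S v) : knTerm μ S a v x η = 0 := by
  have h1 := enorm_knTerm_sq_le a v x η
  rw [Function.notMem_support.mp h, mul_zero, nonpos_iff_eq_zero] at h1
  simpa using h1

/-- The part of `∑_η d_η tr (a(x,η) a(x,η)^*)` carried by the spectrum of `v`. -/
noncomputable def spectralMass (a : PlaneFun S) (v : Lp ℂ 2 μ) (x : G) : ℝ≥0∞ :=
  ∑' η : spectrumSet μ S v, (S.d η : ℝ≥0∞) * hsSq (a η x)

theorem aemeasurable_spectralMass (ha : MemL2 μ S a) (v : Lp ℂ 2 μ) :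
    AEMeasurable (spectralMass a v) μ := by
  have := (countable_spectrumSet (S := S) v).to_subtype
  exact AEMeasurable.tsum fun η => (ha.1.aemeasurable_hsSq η).const_mul _

theorem lintegral_spectralMass_le (ha : MemL2 μ S a) (v : Lp ℂ 2 μ) :
    ∫⁻ x, spectralMass a v x ∂μ ≤ planeSq μ S a := by
  have := (countable_spectrumSet (S := S) v).to_subtype
  unfold spectralMass
  rw [lintegral_tsum fun η : spectrumSet μ S v => (ha.1.aemeasurable_hsSq η).const_mul _]
  simp only [lintegral_const_mul'' _ (ha.1.aemeasurable_hsSq _)]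
  exact ENNReal.tsum_comp_le_tsum_of_injective Subtype.val_injective
    fun η => (S.d η : ℝ≥0∞) * ∫⁻ x, hsSq (a η x) ∂μ

theorem tsum_enorm_knTerm_sq_le (a : PlaneFun S) (v : Lp ℂ 2 μ) (x : G) :
    (∑' η : spectrumSet μ S v, ‖knTerm μ S a v x η‖ₑ) ^ 2 ≤ spectralMass a v x * ‖v‖ₑ ^ 2 := by
  refine (tsum_sq_le fun η : spectrumSet μ S v => enorm_knTerm_sq_le a v x η).trans ?_
  refine mul_le_mul' le_rfl ?_
  rw [← plancherel μ S v]
  exact ENNReal.tsum_comp_le_tsum_of_injective Subtype.val_injective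
    fun η => (S.d η : ℝ≥0∞) * hsSq (fourierCoeff μ S v η)

theorem ae_summable_knTerm_subtype (ha : MemL2 μ S a) (v : Lp ℂ 2 μ) :
    ∀ᵐ x ∂μ, Summable fun η : spectrumSet μ S v => knTerm μ S a v x η := by
  filter_upwards [ae_lt_top' (aemeasurable_spectralMass ha v)
    (ne_top_of_le_ne_top ha.planeSq_ne_top (lintegral_spectralMass_le ha v))] with x hx
  refine Summable.of_enorm fun htop => ?_
  have h := tsum_enorm_knTerm_sq_le a v x
  rw [htop] at h
  exact (ENNReal.mul_lt_top hx (ENNReal.pow_lt_top enorm_lt_top)).not_ge (by simpa using h)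

theorem ae_summable_knTerm (ha : MemL2 μ S a) (v : Lp ℂ 2 μ) :
    ∀ᵐ x ∂μ, Summable (knTerm μ S a v x) := by
  filter_upwards [ae_summable_knTerm_subtype ha v] with x hx
  refine (Subtype.val_injective.summable_iff fun η hη => ?_).mp hx
  exact knTerm_eq_zero a v x (by simpa using hη)

theorem knOperator_eq (a : PlaneFun S) (v : Lp ℂ 2 μ) (x : G) :
    knOperator μ S a v x = ∑' η : spectrumSet μ S v, knTerm μ S a v x η :=
  (tsum_subtype_eq_of_support_subset (f := knTerm μ S a v x) fun η hη => by
    by_contra h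
    exact hη (knTerm_eq_zero a v x h)).symm

theorem aestronglyMeasurable_knTerm (ha : PlaneMeasurable μ S a) (v : Lp ℂ 2 μ)
    (η : UnitaryDual G) : AEStronglyMeasurable (fun x => knTerm μ S a v x η) μ := by
  simp only [knTerm, Matrix.trace, Matrix.diag_apply, Matrix.mul_apply]
  refine AEStronglyMeasurable.const_mul ?_ _
  exact Finset.aestronglyMeasurable_fun_sum _ fun j _ => Finset.aestronglyMeasurable_fun_sum _
    fun k _ => (Finset.aestronglyMeasurable_fun_sum _ fun l _ =>
      ((S.continuous_mat η).matrix_elem j l).aestronglyMeasurable.mul (ha η l k)).mul_const _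

theorem aestronglyMeasurable_knOperator (ha : MemL2 μ S a) (v : Lp ℂ 2 μ) :
    AEStronglyMeasurable (knOperator μ S a v) μ := by
  have := (countable_spectrumSet (S := S) v).to_subtype
  refine aestronglyMeasurable_of_tendsto_ae Filter.atTop
    (f := fun (s : Finset (spectrumSet μ S v)) x => ∑ η ∈ s, knTerm μ S a v x η)
    (fun s => Finset.aestronglyMeasurable_fun_sum _ fun η _ => aestronglyMeasurable_knTerm ha.1 v η)
    ?_
  filter_upwards [ae_summable_knTerm_subtype ha v] with x hx
  rw [knOperator_eq]
  exact hx.hasSum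

theorem enorm_knOperator_sq_le (a : PlaneFun S) (v : Lp ℂ 2 μ) (x : G) :
    ‖knOperator μ S a v x‖ₑ ^ 2 ≤ spectralMass a v x * ‖v‖ₑ ^ 2 := by
  rw [knOperator_eq]
  exact (pow_le_pow_left₀ zero_le enorm_tsum_le_tsum_enorm 2).trans (tsum_enorm_knTerm_sq_le a v x)

theorem lintegral_spectralMass_mul_le (ha : MemL2 μ S a) (v : Lp ℂ 2 μ) :
    ∫⁻ x, spectralMass a v x * ‖v‖ₑ ^ 2 ∂μ ≤ (l2Norm μ S a * ‖v‖ₑ) ^ 2 := by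
  rw [lintegral_mul_const'' _ (aemeasurable_spectralMass ha v), mul_pow, l2Norm_sq]
  gcongr
  exact lintegral_spectralMass_le ha v

theorem eLpNorm_knOperator_le (ha : MemL2 μ S a) (v : Lp ℂ 2 μ) :
    eLpNorm (knOperator μ S a v) 2 μ ≤ l2Norm μ S a * ‖v‖ₑ := by
  rw [← ENNReal.pow_le_pow_left_iff two_ne_zero, eLpNorm_two_sq]
  exact (lintegral_mono fun x => enorm_knOperator_sq_le a v x).trans
    (lintegral_spectralMass_mul_le ha v)

theorem memLp_knOperator (ha : MemL2 μ S a) (v : Lp ℂ 2 μ) : MemLp (knOperator μ S a v) 2 μ :=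
  ⟨aestronglyMeasurable_knOperator ha v,
    (eLpNorm_knOperator_le ha v).trans_lt (ENNReal.mul_lt_top ha.2 enorm_lt_top)⟩

theorem trace_knTransform_mul (a : PlaneFun S) (u v : Lp ℂ 2 μ) (η : UnitaryDual G) (x : G) :
    (S.d η : ℂ) * (knTransform μ S u v η x * (a η x)ᴴ).trace
      = u x * star (knTerm μ S a v x η) := by
  rw [knTerm, star_mul', star_natCast, ← Matrix.trace_conjTranspose, Matrix.conjTranspose_mul,
    Matrix.conjTranspose_mul, knTransform, Matrix.smul_mul, Matrix.trace_smul, smul_eq_mul,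
    Matrix.trace_mul_comm, ← Matrix.mul_assoc, Matrix.trace_mul_comm]
  ring

/-- The pairing may be integrated term by term: by Cauchy–Schwarz and `s t ≤ s² + t²` the terms are
dominated by `|u|²` plus the spectral mass times `‖v‖²`, which is integrable. -/
theorem integral_mul_star_knOperator (ha : MemL2 μ S a) (u v : Lp ℂ 2 μ) :
    ∫ x, u x * star (knOperator μ S a v x) ∂μ
      = planeInner μ S (knTransform μ S u v) a := by
  have := (countable_spectrumSet (S := S) v).to_subtype
  have hmeas : ∀ η, AEStronglyMeasurable (fun x => u x * star (knTerm μ S a v x η)) μ := fun η =>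
    (Lp.aestronglyMeasurable u).mul
      (continuous_star.comp_aestronglyMeasurable (aestronglyMeasurable_knTerm ha.1 v η))
  have hfin : ∑' η : spectrumSet μ S v, ∫⁻ x, ‖u x * star (knTerm μ S a v x η)‖ₑ ∂μ ≠ ∞ := by
    rw [← lintegral_tsum fun η : spectrumSet μ S v => (hmeas η).enorm]
    have hle : ∀ x, ∑' η : spectrumSet μ S v, ‖u x * star (knTerm μ S a v x η)‖ₑ
        ≤ ‖u x‖ₑ ^ 2 + spectralMass a v x * ‖v‖ₑ ^ 2 := fun x => by
      have h1 : ∀ η, ‖u x * star (knTerm μ S a v x η)‖ₑ = ‖u x‖ₑ * ‖knTerm μ S a v x η‖ₑ :=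
        fun η => by
          rw [enorm_mul, ← ofReal_norm (star _), norm_star, ofReal_norm]
      simp only [h1, ENNReal.tsum_mul_left]
      have h2 : ∀ s t : ℝ≥0∞, s * t ≤ s ^ 2 + t ^ 2 := fun s t => by
        rcases le_total s t with h | h
        · exact (mul_le_mul' h le_rfl).trans ((sq t).symm.le.trans le_add_self)
        · exact (mul_le_mul' le_rfl h).trans ((sq s).symm.le.trans le_self_add)
      exact (h2 _ _).trans (by gcongr; exact tsum_enorm_knTerm_sq_le a v x)
    refine ne_top_of_le_ne_top ?_ (lintegral_mono hle)
    rw [lintegral_add_left' ((Lp.aestronglyMeasurable u).enorm.pow_const 2), ← enorm_Lp_sq]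
    exact ENNReal.add_ne_top.mpr ⟨ENNReal.pow_ne_top enorm_ne_top,
      ne_top_of_le_ne_top (ENNReal.pow_ne_top (ENNReal.mul_ne_top ha.2.ne enorm_ne_top))
        (lintegral_spectralMass_mul_le ha v)⟩
  have hop : ∀ x, u x * star (knOperator μ S a v x)
      = ∑' η : spectrumSet μ S v, u x * star (knTerm μ S a v x η) := fun x => by
    rw [knOperator_eq, tsum_star, tsum_mul_left]
  have hterm : ∀ η, (S.d η : ℂ) * ∫ x, (knTransform μ S u v η x * (a η x)ᴴ).trace ∂μ
      = ∫ x, u x * star (knTerm μ S a v x η) ∂μ := fun η => by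
    rw [← integral_const_mul]
    simp only [trace_knTransform_mul]
  simp only [hop]
  rw [integral_tsum (fun η : spectrumSet μ S v => hmeas η) hfin, planeInner, tsum_congr hterm]
  refine tsum_subtype_eq_of_support_subset
    (f := fun η => ∫ x, u x * star (knTerm μ S a v x η) ∂μ) fun η hη => ?_
  by_contra h
  exact hη (by simp [knTerm_eq_zero a v _ h])

end KohnNirenberg

end TimeFreq

/-! ### The main theorem. -/

theorem mainTheorem2 {G : Type*} [Group G] [TopologicalSpace G] [IsTopologicalGroup G]
    [CompactSpace G] [T2Space G] [MeasurableSpace G] [BorelSpace G]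
    (μ : Measure G) [μ.IsHaarMeasure] [IsProbabilityMeasure μ] [μ.Regular]
    (S : TimeFreq.DualSystem G) :
    -- time-frequency transforms with a bounded ambiguity kernel
    (∀ φ : TimeFreq.PlaneFun S, TimeFreq.PlaneMeasurable μ S φ →
      TimeFreq.linftyNorm μ S φ < ∞ →
        -- `D(u,v)` is well defined, with `‖D(u,v)‖ ≤ ‖φ‖_∞ ‖u‖ ‖v‖`
        (∀ u v : Lp ℂ 2 μ,
          Summable (TimeFreq.seriesSnd μ S (TimeFreq.knTransform μ S u v)) ∧
          Summable (TimeFreq.seriesFst μ S (TimeFreq.ambiguity μ S φ u v)) ∧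
          TimeFreq.MemL2 μ S (TimeFreq.tfTransform μ S φ u v) ∧
          TimeFreq.l2Norm μ S (TimeFreq.tfTransform μ S φ u v)
            ≤ TimeFreq.linftyNorm μ S φ * ‖u‖ₑ * ‖v‖ₑ) ∧
        -- `a^D` is well defined, with `‖a^D v‖ ≤ ‖φ‖_∞ ‖a‖ ‖v‖`
        (∀ a : TimeFreq.PlaneFun S, TimeFreq.MemL2 μ S a →
          ∃ A : Lp ℂ 2 μ →L[ℂ] Lp ℂ 2 μ,
            TimeFreq.IsQuantization μ S φ a A ∧
            (∀ B : Lp ℂ 2 μ → Lp ℂ 2 μ, TimeFreq.IsQuantization μ S φ a B → B = A) ∧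
            ∀ v : Lp ℂ 2 μ,
              ‖A v‖ₑ ≤ TimeFreq.linftyNorm μ S φ * TimeFreq.l2Norm μ S a * ‖v‖ₑ)) ∧
    -- the Kohn–Nirenberg transform: `‖R(u,v)‖ = ‖u‖ ‖v‖`
    (∀ u v : Lp ℂ 2 μ,
      TimeFreq.MemL2 μ S (TimeFreq.knTransform μ S u v) ∧
      TimeFreq.l2Norm μ S (TimeFreq.knTransform μ S u v) = ‖u‖ₑ * ‖v‖ₑ) ∧
    -- the Kohn–Nirenberg operator: `⟨u, a^R v⟩ = ⟨R(u,v), a⟩` and `‖a^R v‖ ≤ ‖a‖ ‖v‖`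
    (∀ a : TimeFreq.PlaneFun S, TimeFreq.MemL2 μ S a → ∀ v : Lp ℂ 2 μ,
      (∀ᵐ x ∂μ, Summable (TimeFreq.knTerm μ S a v x)) ∧
      MemLp (TimeFreq.knOperator μ S a v) 2 μ ∧
      (∀ u : Lp ℂ 2 μ, ∫ x, u x * star (TimeFreq.knOperator μ S a v x) ∂μ
        = TimeFreq.planeInner μ S (TimeFreq.knTransform μ S u v) a) ∧
      eLpNorm (TimeFreq.knOperator μ S a v) 2 μ ≤ TimeFreq.l2Norm μ S a * ‖v‖ₑ) := by
  refine ⟨fun φ hφ hfin => ⟨fun u v => ⟨?_, ?_, ?_, ?_⟩, fun a ha => ?_⟩, fun u v => ⟨?_, ?_⟩,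
    fun a ha v => ⟨?_, ?_, fun u => ?_, ?_⟩⟩
  · exact (TimeFreq.memL2_knTransform u v).summable_seriesSnd
  · exact (TimeFreq.memL2_kernel_fourierFst hφ hfin _).summable_seriesFst
  · exact TimeFreq.memL2_tfTransform u v
  · exact TimeFreq.l2Norm_tfTransform_le hφ hfin u v
  · exact TimeFreq.exists_quantization hφ hfin ha
  · exact TimeFreq.memL2_knTransform u v
  · exact TimeFreq.l2Norm_knTransform u v
  · exact TimeFreq.ae_summable_knTerm ha v
  · exact TimeFreq.memLp_knOperator ha v
  · exact TimeFreq.integral_mul_star_knOperator ha u v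
  · exact TimeFreq.eLpNorm_knOperator_le ha v
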